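/- Let $\mathbb C$ be a small category and $\mathcal D$ a class of maps of $\mathbb C$. For $X\in\mathbb C$ let $\mathcal D(X)\subseteq\mathbb C/X$ be the full subcategory on the $\mathcal D$-maps into $X$. Call a map *anodyne* if it has the left lifting property with respect to all maps in $\mathcal D$. Suppose that $\mathcal D$ is * *stable*: pullbacks of $\mathcal D$-maps along arbitrary maps of $\mathbb C$ exist and are in $\mathcal D$; * *closed*: (i) $\mathbb C$ has a terminal object $1$ and every map $X\to 1$ is in $\mathcal D$; (ii) $\mathcal D$ is closed under composition; (iii) for every $d:A\to X$ in $\mathcal D$ the pullback functor $d^*:\mathcal D(X)\to\mathcal D(A)$ has a right adjoint $d_*$, and the inclusions $\mathcal D(X)\hookrightarrow\mathbb C/X$ preserve these relative exponentials, i.e. for every $q\in\mathcal D(A)$ and every object $Y$ of $\mathbb C/X$ (not only of $\mathcal D(X)$), pulling back along $d$ and composing with the counit $d^*d_*q\to q$ is a bijection $\mathrm{Hom}_{\mathbb C/X}(Y,d_*q)\to\mathrm{Hom}_{\mathbb C/A}(d^*Y,q)$; * *factorizing*: every map $f$ of $\mathbb C$ factors as $f=d\circ a$ with $a$ anodyne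 and $d\in\mathcal D$. Define presheaves on $\mathbb C$ by $$\mathcal D_1(X)=\{(a,d): d\in\mathcal D,\ a:X\to\mathrm{dom}(d)\},\qquad \mathcal D_0(X)=\{(b,d): d\in\mathcal D,\ b:X\to\mathrm{cod}(d)\},$$ with action by precomposition in the first component, and let $\pi:\mathcal D_1\to\mathcal D_0$ be $\pi(a,d)=(d\circ a,d)$. For a map $f:B\to A$ of presheaves let $P_f(X)=\sum_{a:A}X^{B_a}$ be the associated polynomial functor on presheaves; write $P=P_\pi$. Then: 1. $\pi$ is a representable natural transformation: the pullback of $\pi$ along any map from a representable presheaf is representable. 2. ($\Sigma$) There are maps $\mathsf{pair}:\sum_{A:\mathcal D_0}\sum_{B:\mathcal D_0^{A}}\sum_{a:A}B(a)\to\mathcal D_1$ and $\Sigma:P(\mathcal D_0)=\sum_{A:\mathcal D_0}\mathcal D_0^{A}\to\mathcal D_0$ such that $\mathsf{pair}$, $\Sigma$, $\pi$ and the projection $\sum_{A}\sum_{B}\sum_{a}B(a)\to P(\mathcal D_0)$ form a pullback square $\pi\circ\mathsf{pair}=\Sigma\circ\mathrm{proj}$. 3. ($\Pi$) There are maps $\lambda:P(\mathcal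 D_1)\to\mathcal D_1$ and $\Pi:P(\mathcal D_0)\to\mathcal D_0$ such that $\pi\circ\lambda=\Pi\circ P(\pi)$ is a pullback square. 4. (Intensional $\mathsf{Id}$) There are maps $\mathsf i:\mathcal D_1\to\mathcal D_1$ and $\mathsf{Id}:\mathcal D_1\times_{\mathcal D_0}\mathcal D_1\to\mathcal D_0$ with $\pi\circ\mathsf i=\mathsf{Id}\circ\delta$, where $\delta$ is the diagonal of $\pi$, such that, with $I$ the pullback of $\pi$ along $\mathsf{Id}$, the induced map $\rho=(\delta,\mathsf i):\mathcal D_1\to I$ has a left-lifting structure with respect to $\pi$ over $\mathcal D_0$: in the category of presheaves over $\mathcal D_0$, with $\mathcal D_0^*$ denoting base change along $\mathcal D_0\to 1$, the comparison map $$(\mathcal D_0^*\mathcal D_1)^{I}\to(\mathcal D_0^*\mathcal D_0)^{I}\times_{(\mathcal D_0^*\mathcal D_0)^{\mathcal D_1}}(\mathcal D_0^*\mathcal D_1)^{\mathcal D_1}$$ induced by $\rho$ and $\pi$ has a section. That is, $\pi$ is a natural model of dependent type theory with sums $\Sigma$, products $\Pi$ and intensional identity types $\mathsf{Id}$. -/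

import Mathlib

open CategoryTheory CategoryTheory.Limits Opposite

universe u

namespace NaturalModel

section Classes

variable {C : Type u} [SmallCategory C]

/-- For `d : A ⟶ X` in a class `D` of maps that has all pullbacks, the base change functor
`d^* : C/X ⥤ C/A` on the full slice categories. -/
noncomputable def slicePullback (D : MorphismProperty C) [D.HasPullbacks] {A X : C} (d : A ⟶ X)
    (hd : D d) : Over X ⥤ Over A :=
  haveI : HasPullbacksAlong d := fun {_} h =>
    haveI : HasPullback d h := D.hasPullback h hd
    hasPullback_symmetry d h
  Over.pullback d

/-- Let `D(X)` (in Lean `D.Over ⊤ X`) be the full subcategory of `C/X` on the maps in `D`, and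
suppose that `R` is right adjoint to `d^* : D(X) ⥤ D(A)`.  A map `g : Y ⟶ R q` in `C/X`, where `Y`
is *any* object of `C/X`, is sent to the composite `d^* Y ⟶ d^* (R q) ⟶ q` of `d^* g` with the
counit of the adjunction, a map in `C/A`. -/
noncomputable def sliceUncurry (D : MorphismProperty C) [D.HasPullbacks]
    [D.IsStableUnderBaseChange] {A X : C} (d : A ⟶ X) (hd : D d)
    {R : D.Over ⊤ A ⥤ D.Over ⊤ X} (adj : MorphismProperty.Over.pullback D ⊤ d ⊣ R)
    (q : D.Over ⊤ A) (Y : Over X)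
    (g : Y ⟶ (MorphismProperty.Over.forget D ⊤ X).obj (R.obj q)) :
    (slicePullback D d hd).obj Y ⟶ (MorphismProperty.Over.forget D ⊤ A).obj q :=
  (slicePullback D d hd).map g ≫ (MorphismProperty.Over.forget D ⊤ A).map (adj.counit.app q)

/-- A stable class of maps `D` (i.e. pullbacks of maps in `D` along arbitrary maps exist and are
in `D`) is closed. -/
structure IsClosedClass (D : MorphismProperty C) [D.HasPullbacks] [D.IsStableUnderBaseChange] :
    Prop where
  /-- There is a terminal object ... -/
  hasTerminal : HasTerminal C
  /-- ... and all maps into it are in `D`. -/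
  of_isTerminal : ∀ {X T : C} (f : X ⟶ T), IsTerminal T → D f
  /-- `D` is closed under composition. -/
  comp_mem : ∀ {X Y Z : C} (f : X ⟶ Y) (g : Y ⟶ Z), D f → D g → D (f ≫ g)
  /-- For `d : A ⟶ X` in `D`, the functor `d^* : D(X) ⥤ D(A)` has a right adjoint `d_*`. -/
  isLeftAdjoint : ∀ {A X : C} (d : A ⟶ X), D d →
    (MorphismProperty.Over.pullback D ⊤ d).IsLeftAdjoint
  /-- The inclusions `D(X) ⥤ C/X` preserve these (relative) exponentials `d_* q`: the bijection
  `Hom (Y, d_* q) ≃ Hom (d^* Y, q)` holds for all objects `Y` of `C/X`, not only those of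
  `D(X)`. -/
  preserves_exponentials : ∀ {A X : C} (d : A ⟶ X) (hd : D d) (R : D.Over ⊤ A ⥤ D.Over ⊤ X)
    (adj : MorphismProperty.Over.pullback D ⊤ d ⊣ R) (q : D.Over ⊤ A) (Y : Over X),
    Function.Bijective (sliceUncurry D d hd adj q Y)

/-- A map is anodyne if it has the left lifting property with respect to all maps in `D`; the class
`D` is factorizing if every map is an anodyne map followed by a map in `D`. -/
def IsFactorizing (D : MorphismProperty C) : Prop :=
  ∀ {A B : C} (f : A ⟶ B), ∃ (B' : C) (a : A ⟶ B') (d : B' ⟶ B), D.llp a ∧ D d ∧ a ≫ d = f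

/-- An element of `D₀(X)`: a map `d` in `D` and a map `b` from `X` to the codomain of `d`. -/
structure TypeIn (D : MorphismProperty C) (X : C) : Type u where
  {tot base : C}
  d : tot ⟶ base
  mem : D d
  b : X ⟶ base

/-- An element of `D₁(X)`: a map `d` in `D` and a map `a` from `X` to the domain of `d`. -/
structure TermIn (D : MorphismProperty C) (X : C) : Type u where
  {tot base : C}
  d : tot ⟶ base
  mem : D d
  a : X ⟶ tot

/-- The presheaf `D₀` of types, acting by precomposition. -/
def typePsh (D : MorphismProperty C) : Cᵒᵖ ⥤ Type u where
  obj X := TypeIn D X.unop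
  map s := ↾fun A => ⟨A.d, A.mem, s.unop ≫ A.b⟩

/-- The presheaf `D₁` of terms, acting by precomposition. -/
def termPsh (D : MorphismProperty C) : Cᵒᵖ ⥤ Type u where
  obj X := TermIn D X.unop
  map s := ↾fun x => ⟨x.d, x.mem, s.unop ≫ x.a⟩

/-- The natural transformation `π : D₁ ⟶ D₀`, composing `a` with `d`. -/
def typing (D : MorphismProperty C) : termPsh D ⟶ typePsh D where
  app _ := ↾fun x => ⟨x.d, x.mem, x.a ≫ x.d⟩
  naturality _ _ _ := by
    ext x
    exact congrArg (fun b => (⟨x.d, x.mem, b⟩ : TypeIn D _)) (Category.assoc _ _ _)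

end Classes

section Polynomial

variable {C : Type u} [SmallCategory C] {A B : Cᵒᵖ ⥤ Type u}

/-- An element at stage `Γ` of the polynomial functor `P_f(X) = ∑_{a : A} X ^ {B_a}` of a map of
presheaves `f : B ⟶ A`: an element `a` of `A(Γ)` and a map of presheaves `yΓ ×_A B ⟶ X`, where the
elements of `yΓ ×_A B` at stage `Δ` are the pairs `(σ, b)` of a map `σ : Δ ⟶ Γ` of `C` and a `b` in
`B(Δ)` such that `f b = a σ`. -/
structure PolyElt (f : B ⟶ A) (X : Cᵒᵖ ⥤ Type u) (Γ : Cᵒᵖ) : Type u where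
  base : A.obj Γ
  val : ∀ ⦃Δ : Cᵒᵖ⦄ (σ : Γ ⟶ Δ) (b : B.obj Δ), f.app Δ b = A.map σ base → X.obj Δ
  naturality : ∀ ⦃Δ Θ : Cᵒᵖ⦄ (σ : Γ ⟶ Δ) (τ : Δ ⟶ Θ) (b : B.obj Δ)
    (h : f.app Δ b = A.map σ base) (h' : f.app Θ (B.map τ b) = A.map (σ ≫ τ) base),
    val (σ ≫ τ) (B.map τ b) h' = X.map τ (val σ b h)

theorem PolyElt.ext' {f : B ⟶ A} {X : Cᵒᵖ ⥤ Type u} {Γ : Cᵒᵖ} {x y : PolyElt f X Γ}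
    (h₁ : x.base = y.base)
    (h₂ : ∀ ⦃Δ : Cᵒᵖ⦄ (σ : Γ ⟶ Δ) (b : B.obj Δ) (h : f.app Δ b = A.map σ x.base)
      (h' : f.app Δ b = A.map σ y.base), x.val σ b h = y.val σ b h') : x = y := by
  obtain ⟨a, v, n⟩ := x
  obtain ⟨a', v', n'⟩ := y
  obtain rfl : a = a' := h₁
  obtain rfl : v = v' := by
    funext Δ σ b h
    exact h₂ σ b h h
  rfl

/-- Dependence of `val` on the substitution, up to equality. -/
theorem PolyElt.val_congr {f : B ⟶ A} {X : Cᵒᵖ ⥤ Type u} {Γ : Cᵒᵖ} (x : PolyElt f X Γ)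
    {Δ : Cᵒᵖ} {σ σ' : Γ ⟶ Δ} {b b' : B.obj Δ} (hσ : σ = σ') (hb : b = b')
    (h : f.app Δ b = A.map σ x.base) (h' : f.app Δ b' = A.map σ' x.base) :
    x.val σ b h = x.val σ' b' h' := by
  subst hσ
  subst hb
  rfl

/-- Reindexing along a map `s : Γ ⟶ Γ'` of `Cᵒᵖ`. -/
def PolyElt.reindex {f : B ⟶ A} {X : Cᵒᵖ ⥤ Type u} {Γ Γ' : Cᵒᵖ} (s : Γ ⟶ Γ')
    (x : PolyElt f X Γ) : PolyElt f X Γ' where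
  base := A.map s x.base
  val _ σ b h := x.val (s ≫ σ) b (by simpa using h)
  naturality _ _ σ τ b h h' :=
    (x.val_congr (Category.assoc s σ τ).symm rfl _
      (by simpa using h')).trans (x.naturality (s ≫ σ) τ b _ _)

/-- Postcomposition with a map `g : X ⟶ Y`. -/
def PolyElt.postcomp {f : B ⟶ A} {X Y : Cᵒᵖ ⥤ Type u} (g : X ⟶ Y) {Γ : Cᵒᵖ}
    (x : PolyElt f X Γ) : PolyElt f Y Γ where
  base := x.base
  val Δ σ b h := g.app Δ (x.val σ b h)
  naturality Δ Θ σ τ b h h' := by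
    rw [x.naturality σ τ b h h', NatTrans.naturality_apply]

/-- Precomposition with a map `h : K ⟶ L` over `A`. -/
def PolyElt.precomp {K L : Cᵒᵖ ⥤ Type u} {k : K ⟶ A} {l : L ⟶ A} (h : K ⟶ L) (w : h ≫ l = k)
    {X : Cᵒᵖ ⥤ Type u} {Γ : Cᵒᵖ} (x : PolyElt l X Γ) : PolyElt k X Γ where
  base := x.base
  val Δ σ b hb := x.val σ (h.app Δ b) (by
    rw [← hb, ← w]
    rfl)
  naturality Δ Θ σ τ b hb hb' :=
    (x.val_congr rfl (NatTrans.naturality_apply h τ b) _ (by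
      rw [← NatTrans.naturality_apply, ← hb', ← w]
      rfl)).trans (x.naturality σ τ (h.app Δ b) _ _)

/-- The polynomial functor `P_f`, an endofunctor of the category of presheaves on `C`. -/
def poly (f : B ⟶ A) : (Cᵒᵖ ⥤ Type u) ⥤ (Cᵒᵖ ⥤ Type u) where
  obj X :=
    { obj := fun Γ => PolyElt f X Γ
      map := fun s => ↾fun x => x.reindex s
      map_id := fun Γ => by
        ext x
        exact PolyElt.ext' (by simp [PolyElt.reindex])
          (fun Δ σ b _ _ => x.val_congr (Category.id_comp σ) rfl _ _)
      map_comp := fun s t => by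
        ext x
        exact PolyElt.ext' (by simp [PolyElt.reindex])
          (fun Δ σ b _ _ => x.val_congr (Category.assoc s t σ) rfl _ _) }
  map g := { app := fun _ => ↾fun x => x.postcomp g }

/-- The projection `P_f(X) ⟶ A`. -/
def polyFst (f : B ⟶ A) (X : Cᵒᵖ ⥤ Type u) : (poly f).obj X ⟶ A where
  app _ := ↾fun x => x.base

/-- For a map `h : K ⟶ L` over `A`, the natural map `P_l(X) ⟶ P_k(X)` by precomposition with `h`.
As an object over `A`, the presheaf `P_k(X)` is the exponential `(A^*X)^K` in the slice over `A`,
and this is the map `(A^*X)^L ⟶ (A^*X)^K`. -/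
def polyRes {K L : Cᵒᵖ ⥤ Type u} {k : K ⟶ A} {l : L ⟶ A} (h : K ⟶ L) (w : h ≫ l = k) :
    poly l ⟶ poly k where
  app _ := { app := fun _ => ↾fun x => x.precomp h w }

end Polynomial

section Rules

variable {C : Type u} [SmallCategory C] {Tm Ty : Cᵒᵖ ⥤ Type u}

/-- `p : Tm ⟶ Ty` models dependent products: there are `λ : P_p(Tm) ⟶ Tm` and `Π : P_p(Ty) ⟶ Ty`
forming a pullback square with `P_p(p)` and `p`. -/
def ModelsPi (p : Tm ⟶ Ty) : Prop :=
  ∃ (lam : (poly p).obj Tm ⟶ Tm) (Pi : (poly p).obj Ty ⟶ Ty),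
    IsPullback lam ((poly p).map p) p Pi

/-- An element at stage `Γ` of `∑_{A : Ty} ∑_{B : Ty^A} ∑_{a : A} B(a)`: a type `A` in context `Γ`
and a type `B` in context `Γ.A` (together an element `fam` of `P_p(Ty)`), a term `a : A` and a term
`b : B[a]`, where `B[a] = B (1, a)`. -/
structure PairElt (p : Tm ⟶ Ty) (Γ : Cᵒᵖ) : Type u where
  fam : PolyElt p Ty Γ
  a : Tm.obj Γ
  ha : p.app Γ a = Ty.map (𝟙 Γ) fam.base
  b : Tm.obj Γ
  hb : p.app Γ b = fam.val (𝟙 Γ) a ha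

theorem PairElt.ext' {p : Tm ⟶ Ty} {Γ : Cᵒᵖ} {x y : PairElt p Γ} (h₁ : x.fam = y.fam)
    (h₂ : x.a = y.a) (h₃ : x.b = y.b) : x = y := by
  cases x
  cases y
  cases h₁
  cases h₂
  cases h₃
  rfl

/-- Reindexing along a map `s : Γ ⟶ Γ'` of `Cᵒᵖ`. -/
def PairElt.reindex {p : Tm ⟶ Ty} {Γ Γ' : Cᵒᵖ} (s : Γ ⟶ Γ') (x : PairElt p Γ) :
    PairElt p Γ' where
  fam := x.fam.reindex s
  a := Tm.map s x.a
  ha := by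
    rw [NatTrans.naturality_apply, x.ha]
    simp [PolyElt.reindex]
  b := Tm.map s x.b
  hb := by
    have h : p.app Γ' (Tm.map s x.a) = Ty.map (𝟙 Γ ≫ s) x.fam.base := by
      rw [NatTrans.naturality_apply, x.ha]
      simp
    rw [NatTrans.naturality_apply, x.hb, ← x.fam.naturality (𝟙 Γ) s x.a x.ha h]
    exact x.fam.val_congr (by simp) rfl _ _

/-- The presheaf `∑_{A : Ty} ∑_{B : Ty^A} ∑_{a : A} B(a)`. -/
def pairPsh (p : Tm ⟶ Ty) : Cᵒᵖ ⥤ Type u where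
  obj Γ := PairElt p Γ
  map s := ↾fun x => x.reindex s
  map_id Γ := by
    ext x
    refine PairElt.ext' ?_ ?_ ?_
    · exact congrArg (fun f => f x.fam) (((poly p).obj Ty).map_id Γ)
    · simp [PairElt.reindex]
    · simp [PairElt.reindex]
  map_comp s t := by
    ext x
    refine PairElt.ext' ?_ ?_ ?_
    · exact congrArg (fun f => f x.fam) (((poly p).obj Ty).map_comp s t)
    · simp [PairElt.reindex]
    · simp [PairElt.reindex]

/-- The projection to `∑_{A : Ty} Ty^A`. -/
def pairProj (p : Tm ⟶ Ty) : pairPsh p ⟶ (poly p).obj Ty where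
  app _ := ↾fun x => x.fam

/-- `p : Tm ⟶ Ty` models (strong) dependent sums: there are `pair` and `Σ` forming a pullback
square with the projection `pairProj p` and `p`. -/
def ModelsSigma (p : Tm ⟶ Ty) : Prop :=
  ∃ (pair : pairPsh p ⟶ Tm) (Sig : (poly p).obj Ty ⟶ Ty),
    IsPullback pair (pairProj p) p Sig

/-- For `h : K ⟶ L` over `U` and `g : Y ⟶ Z`, the comparison map
`(U^*Y)^L ⟶ (U^*Z)^L ×_{(U^*Z)^K} (U^*Y)^K` in presheaves over `U`. -/
noncomputable def comparison {U K L Y Z : Cᵒᵖ ⥤ Type u} {k : K ⟶ U} {l : L ⟶ U} (h : K ⟶ L)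
    (w : h ≫ l = k) (g : Y ⟶ Z) :
    (poly l).obj Y ⟶ pullback ((polyRes h w).app Z) ((poly k).map g) :=
  pullback.lift ((poly l).map g) ((polyRes h w).app Y) ((polyRes h w).naturality g)

/-- A left-lifting structure for `h : K ⟶ L` with respect to `U^*(g)`, both regarded as maps over
`U`: a section of the comparison map. (Any such section is a map over `U`, as the comparison map
is.) -/
structure LeftLiftingStructure {U K L Y Z : Cᵒᵖ ⥤ Type u} {k : K ⟶ U} {l : L ⟶ U} (h : K ⟶ L)
    (w : h ≫ l = k) (g : Y ⟶ Z) where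
  sec : pullback ((polyRes h w).app Z) ((poly k).map g) ⟶ (poly l).obj Y
  sec_comparison : sec ≫ comparison h w g = 𝟙 _

/-- The map `(δ, i) : Tm ⟶ I` to the pullback `I` of `p` along `Id : Tm ×_Ty Tm ⟶ Ty`. -/
noncomputable def idRefl (p : Tm ⟶ Ty) (i : Tm ⟶ Tm) (Id : pullback p p ⟶ Ty)
    (hi : pullback.diagonal p ≫ Id = i ≫ p) : Tm ⟶ pullback Id p :=
  pullback.lift (pullback.diagonal p) i hi

/-- The projection from the pullback `I` of `p` along `Id : Tm ×_Ty Tm ⟶ Ty` to `Ty`. -/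
noncomputable def idProj (p : Tm ⟶ Ty) (Id : pullback p p ⟶ Ty) : pullback Id p ⟶ Ty :=
  pullback.fst Id p ≫ pullback.fst p p ≫ p

theorem idRefl_idProj (p : Tm ⟶ Ty) (i : Tm ⟶ Tm) (Id : pullback p p ⟶ Ty)
    (hi : pullback.diagonal p ≫ Id = i ≫ p) : idRefl p i Id hi ≫ idProj p Id = p := by
  rw [idRefl, idProj, pullback.lift_fst_assoc, pullback.diagonal_fst_assoc]

/-- `p : Tm ⟶ Ty` models intensional identity types: there are `i : Tm ⟶ Tm` and
`Id : Tm ×_Ty Tm ⟶ Ty` with `p ∘ i = Id ∘ δ`, such that `(δ, i) : Tm ⟶ I` has a left-lifting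
structure with respect to `p`, both regarded as maps over `Ty`. -/
def ModelsId (p : Tm ⟶ Ty) : Prop :=
  ∃ (i : Tm ⟶ Tm) (Id : pullback p p ⟶ Ty) (hi : pullback.diagonal p ≫ Id = i ≫ p),
    Nonempty (LeftLiftingStructure (idRefl p i Id hi) (idRefl_idProj p i Id hi) p)

end Rules

end NaturalModel

/-! A type over `Γ` is a map `b : Γ ⟶ U` together with a `D`-map `d : E ⟶ U`, so each type carries
its own small universe `d`. Substitution only precomposes `b`, and is therefore strictly functorial.
Context extension is the pullback of `d` along `b`. This makes `typing D` representable, and by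
Yoneda an element of `P(X)` over `Γ` is a type `A` with one element of `X` over the extension `Γ.A`
(`Comprehension.elt_gen`).

A type former has to commute strictly with substitution, so it is performed once, on a universal
instance depending only on the `D`-maps involved. A type `A` given by `d : E ⟶ U`, with a family `B`
over `Γ.A` given by `d' : E' ⟶ V`, amounts to one map from `Γ` to the exponential `V ^ E` over `U`.
This exponential exists because `V ⟶ 1` is in `D`: it is the pushforward along `d` of the projection
`V × E ⟶ E`. Over it lives a universal family, whose sum is a composite of `D`-maps and whose
product is a pushforward. `Σ` and `Π` keep these fixed `D`-maps and use the classifying map of `(A,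
B)`; strict stability is then naturality of transposition (`classify_subst`). Since contexts are
arbitrary, the universal property of the pushforward is needed against all of `C/X`.

For identity types, the diagonal `E ⟶ E ×_U E` is factored as an anodyne map `refl` followed by a
`D`-map, once for each `d`. Elimination needs diagonal fillers that are natural in the context.
Exponential and pushforward together give an object, with a `D`-map to `U`, classifying all lifting
problems of `refl` against `d'`. Over that object the base change of `refl` is still anodyne by the
Frobenius property (`llp_of_isPullback`), so the universal problem has a filler. One filler is
chosen, and every other problem receives its restriction along the classifying map
(`diagonal_subst`). -/

namespace NaturalModel

/-! ### Pushforwards, fibrewise exponentials and the Frobenius property -/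

section Pushforward

variable {C : Type u} [SmallCategory C] {D : MorphismProperty C}

/-- A pushforward `d_* q` in elementary terms: maps into `obj` over `X` correspond, by composition
with the evaluation `ev`, to maps into `Q` over `A` from any pullback along `d`. -/
structure Pushforward (D : MorphismProperty C) {A X Q : C} (d : A ⟶ X) (q : Q ⟶ A) where
  obj : C
  proj : obj ⟶ X
  mem : D proj
  ev : ∀ {Z : C} (z : Z ⟶ A) (g : Z ⟶ obj), z ≫ d = g ≫ proj → (Z ⟶ Q)
  ev_comp : ∀ {Z : C} (z : Z ⟶ A) (g : Z ⟶ obj) (h : z ≫ d = g ≫ proj), ev z g h ≫ q = z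
  comp_ev : ∀ {T Z : C} (t : T ⟶ Z) (z : Z ⟶ A) (g : Z ⟶ obj) (h : z ≫ d = g ≫ proj),
    t ≫ ev z g h = ev (t ≫ z) (t ≫ g) (by rw [Category.assoc, h, Category.assoc])
  existsUnique : ∀ {Y Z : C} {z₁ : Z ⟶ A} {z₂ : Z ⟶ Y} {y : Y ⟶ X} (sq : IsPullback z₁ z₂ d y)
    (f : Z ⟶ Q), f ≫ q = z₁ →
    ∃! g : Y ⟶ obj, ∃ h : g ≫ proj = y, ev z₁ (z₂ ≫ g) (by rw [Category.assoc, h, sq.w]) = f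

/-- An exponential `V ^ A` over `X`, for `d : A ⟶ X`, in elementary terms. -/
structure FibreExp (D : MorphismProperty C) {A X : C} (d : A ⟶ X) (V : C) where
  obj : C
  proj : obj ⟶ X
  mem : D proj
  ev : ∀ {Z : C} (z : Z ⟶ A) (g : Z ⟶ obj), z ≫ d = g ≫ proj → (Z ⟶ V)
  comp_ev : ∀ {T Z : C} (t : T ⟶ Z) (z : Z ⟶ A) (g : Z ⟶ obj) (h : z ≫ d = g ≫ proj),
    t ≫ ev z g h = ev (t ≫ z) (t ≫ g) (by rw [Category.assoc, h, Category.assoc])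
  existsUnique : ∀ {Y Z : C} {z₁ : Z ⟶ A} {z₂ : Z ⟶ Y} {y : Y ⟶ X} (sq : IsPullback z₁ z₂ d y)
    (f : Z ⟶ V),
    ∃! g : Y ⟶ obj, ∃ h : g ≫ proj = y, ev z₁ (z₂ ≫ g) (by rw [Category.assoc, h, sq.w]) = f

variable [D.HasPullbacks] [D.IsStableUnderBaseChange]

/-- The adjoint supplies the object and its counit `ε`; bijectivity of `sliceUncurry` supplies
unique transposes, also along maps `y` outside `D`. -/
theorem IsClosedClass.exists_counit (hD : IsClosedClass D) {A X Q : C} {d : A ⟶ X}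
    (hd : D d) {q : Q ⟶ A} (hq : D q) :
    ∃ (P : C) (p : P ⟶ X) (_ : D p) (_ : HasPullback p d) (ε : pullback p d ⟶ Q),
      ε ≫ q = pullback.snd p d ∧
      ∀ {Y : C} (y : Y ⟶ X) [HasPullback y d] (f : pullback y d ⟶ Q), f ≫ q = pullback.snd y d →
        ∃! g : Y ⟶ P, ∃ h : g ≫ p = y,
          pullback.lift (pullback.fst y d ≫ g) (pullback.snd y d)
            (by rw [Category.assoc, h, pullback.condition]) ≫ ε = f := by
  have := hD.isLeftAdjoint d hd
  let adj := Adjunction.ofIsLeftAdjoint (MorphismProperty.Over.pullback D ⊤ d)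
  let R := (MorphismProperty.Over.pullback D ⊤ d).rightAdjoint
  let q' : D.Over ⊤ A := MorphismProperty.Over.mk ⊤ q hq
  let P : D.Over ⊤ X := R.obj q'
  have hP : HasPullback P.hom d := D.hasPullback d P.prop
  refine ⟨P.left, P.hom, P.prop, hP, (adj.counit.app q').left,
    MorphismProperty.Over.w (adj.counit.app q'), ?_⟩
  intro Y y _ f hf
  have key := hD.preserves_exponentials d hd R adj q' (Over.mk y)
  let f' : (slicePullback D d hd).obj (Over.mk y) ⟶
      (MorphismProperty.Over.forget D ⊤ A).obj q' := Over.homMk f hf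
  obtain ⟨g, hg⟩ := key.2 f'
  refine ⟨g.left, ⟨Over.w g, congrArg (fun k => k.left) hg⟩, ?_⟩
  rintro g' ⟨h, hg'⟩
  let k : Over.mk y ⟶ (MorphismProperty.Over.forget D ⊤ X).obj P := Over.homMk g' h
  have : k = g := by
    apply key.1
    rw [hg]
    exact Over.OverMorphism.ext hg'
  exact congrArg (fun k => k.left) this

/-- Evaluation pairs the two maps into the pullback and applies the counit. An arbitrary pullback
square is reduced to the chosen one by the comparison isomorphism. -/
theorem IsClosedClass.nonempty_pushforward (hD : IsClosedClass D) {A X Q : C} {d : A ⟶ X}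
    (hd : D d) {q : Q ⟶ A} (hq : D q) : Nonempty (Pushforward D d q) := by
  obtain ⟨P, p, hp, _, ε, hε, key⟩ := hD.exists_counit hd hq
  refine ⟨⟨P, p, hp, fun z g h => pullback.lift g z h.symm ≫ ε, ?_, ?_, ?_⟩⟩
  · intro Z z g h
    rw [Category.assoc, hε, pullback.lift_snd]
  · intro T Z t z g h
    rw [← Category.assoc]
    congr 1
    apply pullback.hom_ext <;> simp only [Category.assoc, pullback.lift_fst, pullback.lift_snd]
  · intro Y Z z₁ z₂ y sq f hf
    have : HasPullback y d := sq.flip.hasPullback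
    let e : Z ≅ pullback y d := sq.flip.isoPullback
    have he₁ : e.hom ≫ pullback.fst y d = z₂ := sq.flip.isoPullback_hom_fst
    have he₂ : e.hom ≫ pullback.snd y d = z₁ := sq.flip.isoPullback_hom_snd
    have unc : ∀ (g : Y ⟶ P) (h : g ≫ p = y),
        e.hom ≫ pullback.lift (pullback.fst y d ≫ g) (pullback.snd y d)
          (by rw [Category.assoc, h, pullback.condition]) =
        pullback.lift (z₂ ≫ g) z₁ (by rw [Category.assoc, h, sq.w]) := by
      intro g h
      apply pullback.hom_ext
      · rw [Category.assoc, pullback.lift_fst, pullback.lift_fst, ← Category.assoc, he₁]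
      · rw [Category.assoc, pullback.lift_snd, pullback.lift_snd, he₂]
    obtain ⟨g, ⟨h, hg⟩, hu⟩ := key y (e.inv ≫ f) (by
      rw [Category.assoc, hf, ← he₂, e.inv_hom_id_assoc])
    refine ⟨g, ⟨h, ?_⟩, ?_⟩
    · rw [← unc g h, Category.assoc, hg, e.hom_inv_id_assoc]
    · rintro g' ⟨h', hg'⟩
      refine hu g' ⟨h', ?_⟩
      rw [← cancel_epi e.hom, e.hom_inv_id_assoc, ← Category.assoc, unc g' h', hg']

/-- The exponential is the pushforward along `d` of the projection `V × A ⟶ A`, a `D`-map because it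
is a pullback of `V ⟶ 1`. -/
theorem IsClosedClass.nonempty_fibreExp (hD : IsClosedClass D) {A X : C} {d : A ⟶ X}
    (hd : D d) (V : C) : Nonempty (FibreExp D d V) := by
  have := hD.hasTerminal
  have hV : D (terminal.from V) := hD.of_isTerminal _ terminalIsTerminal
  have := D.hasPullback (terminal.from A) hV
  have hq : D (pullback.snd (terminal.from V) (terminal.from A)) :=
    D.of_isPullback (IsPullback.of_hasPullback _ _) hV
  obtain ⟨P⟩ := hD.nonempty_pushforward hd hq
  refine ⟨⟨P.obj, P.proj, P.mem, fun z g h => P.ev z g h ≫ pullback.fst _ _, ?_, ?_⟩⟩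
  · intro T Z t z g h
    rw [← P.comp_ev t z g h, Category.assoc]
  · intro Y Z z₁ z₂ y sq f
    obtain ⟨g, ⟨h, hg⟩, hu⟩ := P.existsUnique sq
      (pullback.lift f z₁ (Subsingleton.elim _ _)) (pullback.lift_snd _ _ _)
    refine ⟨g, ⟨h, ?_⟩, ?_⟩
    · rw [hg, pullback.lift_fst]
    · rintro g' ⟨h', hg'⟩
      refine hu g' ⟨h', ?_⟩
      apply pullback.hom_ext
      · rw [hg', pullback.lift_fst]
      · rw [P.ev_comp, pullback.lift_snd]

/-- The Frobenius property: anodyne maps are stable under pullback along maps in `D`. -/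
theorem IsClosedClass.llp_of_isPullback (hD : IsClosedClass D) {E I E' I' : C} {r : E ⟶ I}
    {r' : E' ⟶ I'} {w : I' ⟶ I} {v : E' ⟶ E} (hr : D.llp r) (hw : D w)
    (sq : IsPullback r' v w r) : D.llp r' := by
  intro Q R q hq
  refine ⟨fun {s t} comm => ?_⟩
  have := D.hasPullback t hq
  have hq' : D (pullback.snd q t) := D.of_isPullback (IsPullback.of_hasPullback _ _) hq
  obtain ⟨P⟩ := hD.nonempty_pushforward hw hq'
  -- The problem is moved over `I'` by pulling `q` back along `t`, then transposed along `w` to a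
  -- problem for `r` against the pushforward, which is in `D`. Evaluating a lift of the latter gives
  -- the required diagonal.
  obtain ⟨g, ⟨h, hg⟩, -⟩ := P.existsUnique sq
    (pullback.lift s r' comm.w) (pullback.lift_snd _ _ _)
  have : HasLiftingProperty r P.proj := hr _ P.mem
  have sq' : CommSq g r P.proj (𝟙 I) := ⟨by rw [h, Category.comp_id]⟩
  have h₁ : 𝟙 I' ≫ w = (w ≫ sq'.lift) ≫ P.proj := by simp
  have hl : r' ≫ P.ev (𝟙 I') (w ≫ sq'.lift) h₁ = pullback.lift s r' comm.w := by
    rw [P.comp_ev, ← hg]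
    congr 1
    · simp
    · rw [← Category.assoc, sq.w, Category.assoc, sq'.fac_left]
  have hl' := P.ev_comp (𝟙 I') (w ≫ sq'.lift) h₁
  refine ⟨⟨⟨P.ev (𝟙 I') (w ≫ sq'.lift) h₁ ≫ pullback.fst q t, ?_, ?_⟩⟩⟩
  · rw [← Category.assoc, hl, pullback.lift_fst]
  · rw [Category.assoc, pullback.condition, ← Category.assoc, hl', Category.id_comp]

end Pushforward

/-! ### Pullbacks of presheaves, elementwise -/

section Presheaves

variable {C : Type u} [SmallCategory C]

theorem isPullback_of_elements {P X Y Z : Cᵒᵖ ⥤ Type u} {t : P ⟶ X} {l : P ⟶ Y} {r : X ⟶ Z}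
    {b : Y ⟶ Z} (w : t ≫ r = l ≫ b)
    (inj : ∀ (Γ : Cᵒᵖ) (x y : P.obj Γ), t.app Γ x = t.app Γ y → l.app Γ x = l.app Γ y → x = y)
    (surj : ∀ (Γ : Cᵒᵖ) (x : X.obj Γ) (y : Y.obj Γ), r.app Γ x = b.app Γ y →
      ∃ p, t.app Γ p = x ∧ l.app Γ p = y) : IsPullback t l r b :=
  .of_forall_isPullback_app fun Γ => (Types.isPullback_iff _ _ _ _).2
    ⟨congrArg (fun k => k.app Γ) w, fun x y h => inj Γ x y h.1 h.2, surj Γ⟩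

variable {X Y Z : Cᵒᵖ ⥤ Type u} (f : X ⟶ Z) (g : Y ⟶ Z)

theorem types_isPullback_app (Γ : Cᵒᵖ) : IsPullback ((pullback.fst f g).app Γ)
    ((pullback.snd f g).app Γ) (f.app Γ) (g.app Γ) :=
  (IsPullback.of_hasPullback f g).map ((evaluation Cᵒᵖ (Type u)).obj Γ)

variable {f g}

theorem pullback_condition_app {Γ : Cᵒᵖ} (z : (pullback f g).obj Γ) :
    f.app Γ ((pullback.fst f g).app Γ z) = g.app Γ ((pullback.snd f g).app Γ z) :=
  types_comp_apply _ _ _ ▸ congrArg (fun k => k z) (types_isPullback_app f g Γ).w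

theorem pullback_elt_ext {Γ : Cᵒᵖ} {z z' : (pullback f g).obj Γ}
    (h₁ : (pullback.fst f g).app Γ z = (pullback.fst f g).app Γ z')
    (h₂ : (pullback.snd f g).app Γ z = (pullback.snd f g).app Γ z') : z = z' :=
  ((Types.isPullback_iff _ _ _ _).1 (types_isPullback_app f g Γ)).2.1 z z' ⟨h₁, h₂⟩

theorem exists_pullback_elt {Γ : Cᵒᵖ} (x : X.obj Γ) (y : Y.obj Γ) (h : f.app Γ x = g.app Γ y) :
    ∃ z, (pullback.fst f g).app Γ z = x ∧ (pullback.snd f g).app Γ z = y :=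
  ((Types.isPullback_iff _ _ _ _).1 (types_isPullback_app f g Γ)).2.2 x y h

theorem pullback_lift_app_fst {W : Cᵒᵖ ⥤ Type u} (a : W ⟶ X) (b : W ⟶ Y) (w : a ≫ f = b ≫ g)
    {Γ : Cᵒᵖ} (x : W.obj Γ) :
    (pullback.fst f g).app Γ ((pullback.lift a b w).app Γ x) = a.app Γ x :=
  congrArg (fun k => k.app Γ x) (pullback.lift_fst a b w)

theorem pullback_lift_app_snd {W : Cᵒᵖ ⥤ Type u} (a : W ⟶ X) (b : W ⟶ Y) (w : a ≫ f = b ≫ g)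
    {Γ : Cᵒᵖ} (x : W.obj Γ) :
    (pullback.snd f g).app Γ ((pullback.lift a b w).app Γ x) = b.app Γ x :=
  congrArg (fun k => k.app Γ x) (pullback.lift_snd a b w)

end Presheaves

/-! ### Comprehension and generic elements of polynomial functors -/

section Comprehension

variable {C : Type u} [SmallCategory C] {A B : Cᵒᵖ ⥤ Type u}

/-- A comprehension structure on a map of presheaves `f : B ⟶ A`: for each `a : A(Γ)` an object
`ext a` representing the pullback of `f` along `a`. -/
structure Comprehension (f : B ⟶ A) where
  ext : ∀ {Γ : Cᵒᵖ}, A.obj Γ → Cᵒᵖ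
  wk : ∀ {Γ : Cᵒᵖ} (a : A.obj Γ), Γ ⟶ ext a
  var : ∀ {Γ : Cᵒᵖ} (a : A.obj Γ), B.obj (ext a)
  app_var : ∀ {Γ : Cᵒᵖ} (a : A.obj Γ), f.app _ (var a) = A.map (wk a) a
  lift : ∀ {Γ Δ : Cᵒᵖ} (a : A.obj Γ) (σ : Γ ⟶ Δ) (b : B.obj Δ), f.app Δ b = A.map σ a →
    (ext a ⟶ Δ)
  wk_lift : ∀ {Γ Δ : Cᵒᵖ} (a : A.obj Γ) (σ : Γ ⟶ Δ) (b : B.obj Δ) (h : f.app Δ b = A.map σ a),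
    wk a ≫ lift a σ b h = σ
  map_lift : ∀ {Γ Δ : Cᵒᵖ} (a : A.obj Γ) (σ : Γ ⟶ Δ) (b : B.obj Δ) (h : f.app Δ b = A.map σ a),
    B.map (lift a σ b h) (var a) = b
  hom_ext : ∀ {Γ Δ : Cᵒᵖ} {a : A.obj Γ} {t t' : ext a ⟶ Δ}, wk a ≫ t = wk a ≫ t' →
    B.map t (var a) = B.map t' (var a) → t = t'

namespace Comprehension

variable {f : B ⟶ A} (K : Comprehension f)

/-- The extension represents the pullback: `hom_ext` says that a map out of `ext a` in `Cᵒᵖ` is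
determined by its pair `(σ, b)`, and `lift` says that every compatible pair occurs. -/
theorem relativelyRepresentable (K : Comprehension f) : yoneda.relativelyRepresentable f := by
  intro X g
  obtain ⟨a, rfl⟩ := yonedaEquiv.symm.surjective g
  have hg : ∀ (Δ : Cᵒᵖ) (σ : (yoneda.obj X).obj Δ),
      (yonedaEquiv.symm a).app Δ σ = A.map (Quiver.Hom.op σ) a := fun _ _ => rfl
  have hv : ∀ (Δ : Cᵒᵖ) (σ : (yoneda.obj (K.ext a).unop).obj Δ),
      (yonedaEquiv.symm (K.var a)).app Δ σ = B.map (Quiver.Hom.op σ) (K.var a) := fun _ _ => rfl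
  refine ⟨(K.ext a).unop, (K.wk a).unop, yonedaEquiv.symm (K.var a), ?_⟩
  refine isPullback_of_elements ?_ ?_ ?_
  · ext Δ σ
    change f.app Δ (B.map (Quiver.Hom.op σ) (K.var a)) = A.map (K.wk a ≫ Quiver.Hom.op σ) a
    rw [NatTrans.naturality_apply, K.app_var, Functor.map_comp_apply]
  · intro Δ t t' h₁ h₂
    rw [hv, hv] at h₁
    exact Quiver.Hom.op_inj (K.hom_ext (congrArg Quiver.Hom.op h₂) h₁)
  · intro Δ b σ h
    rw [hg] at h
    refine ⟨(K.lift a (Quiver.Hom.op σ) b h).unop, ?_, ?_⟩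
    · exact K.map_lift _ _ _ _
    · exact congrArg Quiver.Hom.unop (K.wk_lift _ _ _ _)

variable {X Y Z : Cᵒᵖ ⥤ Type u}

@[simp]
theorem lift_wk_var {Γ : Cᵒᵖ} (a : A.obj Γ) : K.lift a (K.wk a) (K.var a) (K.app_var a) = 𝟙 _ :=
  K.hom_ext (by rw [K.wk_lift, Category.comp_id]) (by simp [K.map_lift])

theorem lift_comp {Γ Δ Θ : Cᵒᵖ} (a : A.obj Γ) (σ : Γ ⟶ Δ) (b : B.obj Δ)
    (h : f.app Δ b = A.map σ a) (τ : Δ ⟶ Θ) :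
    K.lift a σ b h ≫ τ = K.lift a (σ ≫ τ) (B.map τ b) (by
      rw [NatTrans.naturality_apply, h, Functor.map_comp_apply]) :=
  K.hom_ext (by rw [K.wk_lift, ← Category.assoc, K.wk_lift])
    (by rw [Functor.map_comp_apply, K.map_lift, K.map_lift])

/-- The action of substitutions on context extensions. -/
def extMap {Γ Γ' : Cᵒᵖ} (s : Γ ⟶ Γ') (a : A.obj Γ) : K.ext a ⟶ K.ext (A.map s a) :=
  K.lift a (s ≫ K.wk _) (K.var _) (by rw [K.app_var, Functor.map_comp_apply])

theorem wk_extMap {Γ Γ' : Cᵒᵖ} (s : Γ ⟶ Γ') (a : A.obj Γ) :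
    K.wk a ≫ K.extMap s a = s ≫ K.wk _ := K.wk_lift _ _ _ _

theorem map_extMap_var {Γ Γ' : Cᵒᵖ} (s : Γ ⟶ Γ') (a : A.obj Γ) :
    B.map (K.extMap s a) (K.var a) = K.var _ := K.map_lift _ _ _ _

theorem lift_reindex {Γ Γ' Δ : Cᵒᵖ} (s : Γ ⟶ Γ') (a : A.obj Γ) (σ : Γ' ⟶ Δ) (b : B.obj Δ)
    (h : f.app Δ b = A.map (s ≫ σ) a) (h' : f.app Δ b = A.map σ (A.map s a)) :
    K.lift a (s ≫ σ) b h = K.extMap s a ≫ K.lift (A.map s a) σ b h' :=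
  K.hom_ext (by rw [K.wk_lift, ← Category.assoc, K.wk_extMap, Category.assoc, K.wk_lift])
    (by rw [K.map_lift, Functor.map_comp_apply, K.map_extMap_var, K.map_lift])

/-- The element of `P_f(X)(Γ)` given by `a : A(Γ)` and an element of `X` over the extension of `Γ`
by `a`. -/
def elt {Γ : Cᵒᵖ} (a : A.obj Γ) (e : X.obj (K.ext a)) : PolyElt f X Γ where
  base := a
  val _ σ b h := X.map (K.lift a σ b h) e
  naturality _ _ σ τ b h h' := by rw [← Functor.map_comp_apply, K.lift_comp]

/-- The generic value of an element of `P_f(X)`. -/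
def gen {Γ : Cᵒᵖ} (x : PolyElt f X Γ) (a : A.obj Γ) (h : x.base = a) : X.obj (K.ext a) :=
  x.val (K.wk a) (K.var a) (by rw [h, K.app_var])

@[simp]
theorem gen_elt {Γ : Cᵒᵖ} (a : A.obj Γ) (e : X.obj (K.ext a)) : K.gen (K.elt a e) a rfl = e := by
  change X.map (K.lift a (K.wk a) (K.var a) _) e = e
  rw [K.lift_wk_var, Functor.map_id_apply]

/-- The Yoneda argument: every pair `(σ, b)` is the image of the generic pair `(wk, var)` under
`lift`, so naturality determines `val` from its generic value. -/
theorem val_eq {Γ Δ : Cᵒᵖ} (x : PolyElt f X Γ) (σ : Γ ⟶ Δ) (b : B.obj Δ)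
    (h : f.app Δ b = A.map σ x.base) :
    x.val σ b h = X.map (K.lift x.base σ b h) (K.gen x x.base rfl) := by
  refine Eq.trans ?_ (x.naturality (K.wk _) (K.lift _ σ b h) (K.var _) _
    (by rw [K.map_lift, K.wk_lift, h]))
  exact x.val_congr (K.wk_lift _ _ _ _).symm (K.map_lift _ _ _ _).symm _ _

theorem elt_gen {Γ : Cᵒᵖ} (x : PolyElt f X Γ) (a : A.obj Γ) (h : x.base = a) :
    K.elt a (K.gen x a h) = x := by
  subst h
  exact PolyElt.ext' rfl fun Δ σ b h h' => (K.val_eq x σ b h').symm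

theorem exists_elt {Γ : Cᵒᵖ} (x : PolyElt f X Γ) : ∃ a e, x = K.elt a e :=
  ⟨x.base, K.gen x _ rfl, (K.elt_gen _ _ _).symm⟩

theorem exists_elt_of_base {Γ : Cᵒᵖ} (x : PolyElt f X Γ) {a : A.obj Γ} (h : x.base = a) :
    ∃ e, x = K.elt a e :=
  ⟨K.gen x a h, (K.elt_gen _ _ _).symm⟩

theorem elt_injective {Γ : Cᵒᵖ} {a : A.obj Γ} {e e' : X.obj (K.ext a)} (h : K.elt a e = K.elt a e')
    :
    e = e' := by
  rw [← K.gen_elt a e, ← K.gen_elt a e']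
  congr 1

theorem reindex_elt {Γ Γ' : Cᵒᵖ} (s : Γ ⟶ Γ') (a : A.obj Γ) (e : X.obj (K.ext a)) :
    (K.elt a e).reindex s = K.elt (A.map s a) (X.map (K.extMap s a) e) := by
  refine PolyElt.ext' rfl fun Δ σ b h h' => ?_
  change X.map (K.lift _ _ _ _) e = X.map (K.lift _ _ _ _) (X.map _ e)
  rw [← Functor.map_comp_apply]
  exact congrArg (fun m => X.map m e) (K.lift_reindex s a σ b _ _)

theorem postcomp_elt (g : X ⟶ Y) {Γ : Cᵒᵖ} (a : A.obj Γ) (e : X.obj (K.ext a)) :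
    (K.elt a e).postcomp g = K.elt a (g.app _ e) :=
  PolyElt.ext' rfl fun _ _ _ _ _ => NatTrans.naturality_apply g _ _

/-- Maps out of `P_f(X)`, given on generic values. -/
def polyDesc (F : ∀ {Γ : Cᵒᵖ} (a : A.obj Γ), X.obj (K.ext a) → Y.obj Γ)
    (hF : ∀ {Γ Γ' : Cᵒᵖ} (s : Γ ⟶ Γ') (a : A.obj Γ) (e : X.obj (K.ext a)),
      F (A.map s a) (X.map (K.extMap s a) e) = Y.map s (F a e)) : (poly f).obj X ⟶ Y where
  app _ := ↾fun x => F x.base (K.gen x x.base rfl)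
  naturality Γ Γ' s := by
    ext x
    obtain ⟨a, e, rfl⟩ := K.exists_elt x
    refine (congrArg (fun x : PolyElt f X Γ' => F x.base (K.gen x x.base rfl))
      (K.reindex_elt s a e)).trans ?_
    change F (A.map s a) (K.gen (K.elt (A.map s a) _) (A.map s a) rfl) =
      Y.map s (F a (K.gen (K.elt a e) a rfl))
    rw [gen_elt, gen_elt, hF]

end Comprehension

/-! ### Left-lifting structures from natural fillers at generic values -/

variable {K L : Cᵒᵖ ⥤ Type u} {k : K ⟶ A} {l : L ⟶ A} (EK : Comprehension k)
  (EL : Comprehension l) (h : K ⟶ L) {Y Z : Cᵒᵖ ⥤ Type u} (g : Y ⟶ Z)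

/-- The map of context extensions represented by a map `h : K ⟶ L` over `A`. -/
def Comprehension.compare (w : h ≫ l = k) {Γ : Cᵒᵖ} (a : A.obj Γ) : EL.ext a ⟶ EK.ext a :=
  EL.lift a (EK.wk a) (h.app _ (EK.var a)) 
    ((types_comp_apply _ _ _).symm.trans
      ((congrArg (fun m => m.app _ (EK.var a)) w).trans (EK.app_var a)))

theorem Comprehension.lift_compare (w : h ≫ l = k) {Γ Δ : Cᵒᵖ} (a : A.obj Γ) (σ : Γ ⟶ Δ)
    (b : K.obj Δ) (hb : k.app Δ b = A.map σ a) (hb' : l.app Δ (h.app Δ b) = A.map σ a) :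
    Comprehension.compare EK EL h w a ≫ EK.lift a σ b hb = EL.lift a σ (h.app Δ b) hb' :=
  EL.hom_ext
    (by rw [Comprehension.compare, ← Category.assoc, EL.wk_lift, EK.wk_lift, EL.wk_lift])
    (by rw [Comprehension.compare, Functor.map_comp_apply, EL.map_lift,
      ← NatTrans.naturality_apply, EK.map_lift, EL.map_lift])

/-- On generic values, precomposition with `h` is restriction along `compare`. This turns the
comparison map of exponentials into ordinary lifting problems over extensions. -/
theorem Comprehension.precomp_elt (w : h ≫ l = k) {Γ : Cᵒᵖ} (a : A.obj Γ) (e : Y.obj (EL.ext a)) :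
    (EL.elt a e).precomp h w = EK.elt a (Y.map (Comprehension.compare EK EL h w a) e) := by
  refine PolyElt.ext' rfl fun Δ σ b hb hb' => ?_
  change Y.map (EL.lift _ _ _ _) e = Y.map (EK.lift _ _ _ _) (Y.map (EL.lift _ _ _ _) e)
  rw [← Functor.map_comp_apply]
  exact congrArg (fun m => Y.map m e) (Comprehension.lift_compare EK EL h w a σ b hb' _).symm

/-- Diagonal fillers at the generic values, natural in the stage. -/
structure GenericFillers (w : h ≫ l = k) where
  fill : ∀ {Γ : Cᵒᵖ} (a : A.obj Γ) (x : Z.obj (EL.ext a)) (y : Y.obj (EK.ext a)),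
    Z.map (Comprehension.compare EK EL h w a) x = g.app _ y → Y.obj (EL.ext a)
  app_fill : ∀ {Γ : Cᵒᵖ} (a : A.obj Γ) (x : Z.obj (EL.ext a)) (y : Y.obj (EK.ext a))
    (e : Z.map (Comprehension.compare EK EL h w a) x = g.app _ y), g.app _ (fill a x y e) = x
  map_fill : ∀ {Γ : Cᵒᵖ} (a : A.obj Γ) (x : Z.obj (EL.ext a)) (y : Y.obj (EK.ext a))
    (e : Z.map (Comprehension.compare EK EL h w a) x = g.app _ y),
    Y.map (Comprehension.compare EK EL h w a) (fill a x y e) = y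
  fill_map : ∀ {Γ Γ' : Cᵒᵖ} (s : Γ ⟶ Γ') (a : A.obj Γ) (x : Z.obj (EL.ext a))
    (y : Y.obj (EK.ext a)) (e : Z.map (Comprehension.compare EK EL h w a) x = g.app _ y)
    (e' : Z.map (Comprehension.compare EK EL h w (A.map s a)) (Z.map (EL.extMap s a) x) =
      g.app _ (Y.map (EK.extMap s a) y)),
    fill (A.map s a) (Z.map (EL.extMap s a) x) (Y.map (EK.extMap s a) y) e' =
      Y.map (EL.extMap s a) (fill a x y e)

namespace GenericFillers

variable {EK EL h g} {w : h ≫ l = k} (F : GenericFillers EK EL h g w)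

theorem base_eq {Γ : Cᵒᵖ} {x : PolyElt l Z Γ} {y : PolyElt k Y Γ}
    (e : x.precomp h w = y.postcomp g) : y.base = x.base :=
  (congrArg PolyElt.base e).symm

theorem compat {Γ : Cᵒᵖ} {x' : PolyElt l Z Γ} {y' : PolyElt k Y Γ}
    (e : x'.precomp h w = y'.postcomp g) {a : A.obj Γ} {x : Z.obj (EL.ext a)}
    {y : Y.obj (EK.ext a)} (hx : x' = EL.elt a x) (hy : y' = EK.elt a y) :
    Z.map (Comprehension.compare EK EL h w a) x = g.app _ y := by
  rw [hx, hy, Comprehension.precomp_elt EK, EK.postcomp_elt] at e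
  exact EK.elt_injective e

/-- The filler of an element of the pullback. -/
def fillElt {Γ : Cᵒᵖ} (x : PolyElt l Z Γ) (y : PolyElt k Y Γ)
    (e : x.precomp h w = y.postcomp g) : PolyElt l Y Γ :=
  EL.elt x.base (F.fill x.base (EL.gen x x.base rfl) (EK.gen y x.base (base_eq e))
    (compat e (EL.elt_gen _ _ _).symm (EK.elt_gen _ _ _).symm))

/-- The filler may be computed from any presentation of the two elements over a common base, which
avoids transport along equalities of bases. -/
theorem fillElt_eq {Γ : Cᵒᵖ} {x' : PolyElt l Z Γ} {y' : PolyElt k Y Γ}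
    (e : x'.precomp h w = y'.postcomp g) (a : A.obj Γ) (x : Z.obj (EL.ext a))
    (y : Y.obj (EK.ext a)) (hx : x' = EL.elt a x) (hy : y' = EK.elt a y)
    (e' : Z.map (Comprehension.compare EK EL h w a) x = g.app _ y) :
    F.fillElt x' y' e = EL.elt a (F.fill a x y e') := by
  subst hx hy
  change EL.elt a (F.fill a (EL.gen (EL.elt a x) a rfl) (EK.gen (EK.elt a y) a rfl) _) = _
  congr 2
  · exact EL.gen_elt a x
  · exact EK.gen_elt a y

variable (EK EL) in
theorem exists_elt {Γ : Cᵒᵖ} (z : (pullback ((polyRes h w).app Z) ((poly k).map g)).obj Γ) :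
    ∃ a x y, (pullback.fst ((polyRes h w).app Z) ((poly k).map g)).app Γ z = EL.elt a x ∧
      (pullback.snd ((polyRes h w).app Z) ((poly k).map g)).app Γ z = EK.elt a y := by
  have e := pullback_condition_app z
  obtain ⟨a, x, hx⟩ := EL.exists_elt
    ((pullback.fst ((polyRes h w).app Z) ((poly k).map g)).app Γ z : PolyElt l Z Γ)
  obtain ⟨y, hy⟩ := EK.exists_elt_of_base
    ((pullback.snd ((polyRes h w).app Z) ((poly k).map g)).app Γ z : PolyElt k Y Γ)
    (a := a) ((base_eq (w := w) (g := g) e).trans (congrArg PolyElt.base hx))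
  exact ⟨a, x, y, hx, hy⟩

/-- The section of the comparison map given by the fillers. -/
noncomputable def sec :
    pullback ((polyRes h w).app Z) ((poly k).map g) ⟶ (poly l).obj Y where
  app Γ := ↾fun z => F.fillElt ((pullback.fst ((polyRes h w).app Z) ((poly k).map g)).app Γ z)
    ((pullback.snd ((polyRes h w).app Z) ((poly k).map g)).app Γ z) (pullback_condition_app z)
  naturality Γ Γ' s := by
    ext z
    have e := pullback_condition_app z
    obtain ⟨a, x, y, hx, hy⟩ := exists_elt EK EL z
    have hx' : (pullback.fst ((polyRes h w).app Z) ((poly k).map g)).app Γ'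
        ((pullback ((polyRes h w).app Z) ((poly k).map g)).map s z) =
        EL.elt (A.map s a) (Z.map (EL.extMap s a) x) := by
      rw [NatTrans.naturality_apply, hx]
      exact EL.reindex_elt s a x
    have hy' : (pullback.snd ((polyRes h w).app Z) ((poly k).map g)).app Γ'
        ((pullback ((polyRes h w).app Z) ((poly k).map g)).map s z) =
        EK.elt (A.map s a) (Y.map (EK.extMap s a) y) := by
      rw [NatTrans.naturality_apply, hy]
      exact EK.reindex_elt s a y
    have e' := pullback_condition_app
      ((pullback ((polyRes h w).app Z) ((poly k).map g)).map s z)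
    have c := compat (w := w) (g := g) e hx hy
    have c' := compat (w := w) (g := g) e' hx' hy'
    refine (F.fillElt_eq e' _ _ _ hx' hy' c').trans ?_
    refine Eq.trans ?_ (congrArg (PolyElt.reindex s) (F.fillElt_eq e _ _ _ hx hy c)).symm
    rw [F.fill_map _ _ _ _ c, EL.reindex_elt]

/-- The left lifting structure given by the fillers. -/
noncomputable def leftLiftingStructure : LeftLiftingStructure h w g where
  sec := F.sec
  sec_comparison := by
    refine NatTrans.ext (funext fun Γ => ConcreteCategory.hom_ext _ _ fun z => ?_)
    obtain ⟨a, x, y, hx, hy⟩ := exists_elt EK EL z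
    have e := pullback_condition_app z
    have c := compat (w := w) (g := g) e hx hy
    have hs : F.sec.app Γ z = EL.elt a (F.fill a x y c) := F.fillElt_eq e _ _ _ hx hy c
    apply pullback_elt_ext
    · change (pullback.fst ((polyRes h w).app Z) ((poly k).map g)).app Γ
        ((comparison h w g).app Γ (F.sec.app Γ z)) =
        (pullback.fst ((polyRes h w).app Z) ((poly k).map g)).app Γ z
      rw [hs, hx]
      refine (pullback_lift_app_fst _ _ _ _).trans ((EL.postcomp_elt g a _).trans ?_)
      rw [F.app_fill]
    · change (pullback.snd ((polyRes h w).app Z) ((poly k).map g)).app Γ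
        ((comparison h w g).app Γ (F.sec.app Γ z)) =
        (pullback.snd ((polyRes h w).app Z) ((poly k).map g)).app Γ z
      rw [hs, hy]
      refine (pullback_lift_app_snd _ _ _ _).trans
        ((Comprehension.precomp_elt EK EL h w a _).trans ?_)
      rw [F.map_fill]

end GenericFillers

end Comprehension

/-! ### Transposition and its naturality -/

section Curry

variable {C : Type u} [SmallCategory C] {D : MorphismProperty C} {A X Q V : C} {d : A ⟶ X}
  {q : Q ⟶ A} {Y Z : C} {z₁ : Z ⟶ A} {z₂ : Z ⟶ Y} {y : Y ⟶ X}

namespace Pushforward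

variable (P : Pushforward D d q)

/-- The transpose of a map out of a pullback. -/
noncomputable def curry (sq : IsPullback z₁ z₂ d y) (f : Z ⟶ Q) (hf : f ≫ q = z₁) : Y ⟶ P.obj :=
  (P.existsUnique sq f hf).choose

@[simp]
theorem curry_proj (sq : IsPullback z₁ z₂ d y) (f : Z ⟶ Q) (hf : f ≫ q = z₁) :
    P.curry sq f hf ≫ P.proj = y :=
  (P.existsUnique sq f hf).choose_spec.1.choose

theorem ev_curry (sq : IsPullback z₁ z₂ d y) (f : Z ⟶ Q) (hf : f ≫ q = z₁)
    (h : z₁ ≫ d = (z₂ ≫ P.curry sq f hf) ≫ P.proj) : P.ev z₁ (z₂ ≫ P.curry sq f hf) h = f :=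
  (P.existsUnique sq f hf).choose_spec.1.choose_spec

theorem eq_curry (sq : IsPullback z₁ z₂ d y) (f : Z ⟶ Q) (hf : f ≫ q = z₁) (g : Y ⟶ P.obj)
    (hg : g ≫ P.proj = y) (h : z₁ ≫ d = (z₂ ≫ g) ≫ P.proj) (hf' : P.ev z₁ (z₂ ≫ g) h = f) :
    g = P.curry sq f hf :=
  (P.existsUnique sq f hf).choose_spec.2 g ⟨hg, hf'⟩

/-- By uniqueness of transposes and stability of `ev` under precomposition. Strict stability of
abstraction and of lifting problems under substitution comes from here. -/
theorem comp_curry (sq : IsPullback z₁ z₂ d y) (f : Z ⟶ Q) (hf : f ≫ q = z₁) {Y' Z' : C}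
    {z₁' : Z' ⟶ A} {z₂' : Z' ⟶ Y'} {s : Y' ⟶ Y} {y' : Y' ⟶ X} (sq' : IsPullback z₁' z₂' d y')
    (t : Z' ⟶ Z) (f' : Z' ⟶ Q) (hf' : f' ≫ q = z₁') (hy : s ≫ y = y') (h₁ : t ≫ z₁ = z₁')
    (h₂ : t ≫ z₂ = z₂' ≫ s) (h : t ≫ f = f') : s ≫ P.curry sq f hf = P.curry sq' f' hf' := by
  have e : z₁ ≫ d = (z₂ ≫ P.curry sq f hf) ≫ P.proj := by simp [sq.w]
  refine P.eq_curry _ _ _ _ (by simp [hy]) (by simp [hy, sq'.w]) ?_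
  have := P.comp_ev t _ _ e
  rw [P.ev_curry, h] at this
  rw [this]
  congr 1
  · exact h₁.symm
  · rw [← Category.assoc, ← Category.assoc, h₂]

end Pushforward

namespace FibreExp

variable (W : FibreExp D d V)

/-- The transpose of a map out of a pullback. -/
noncomputable def curry (sq : IsPullback z₁ z₂ d y) (f : Z ⟶ V) : Y ⟶ W.obj :=
  (W.existsUnique sq f).choose

@[simp]
theorem curry_proj (sq : IsPullback z₁ z₂ d y) (f : Z ⟶ V) : W.curry sq f ≫ W.proj = y :=
  (W.existsUnique sq f).choose_spec.1.choose

theorem ev_curry (sq : IsPullback z₁ z₂ d y) (f : Z ⟶ V)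
    (h : z₁ ≫ d = (z₂ ≫ W.curry sq f) ≫ W.proj) : W.ev z₁ (z₂ ≫ W.curry sq f) h = f :=
  (W.existsUnique sq f).choose_spec.1.choose_spec

theorem eq_curry (sq : IsPullback z₁ z₂ d y) (f : Z ⟶ V) (g : Y ⟶ W.obj)
    (hg : g ≫ W.proj = y) (h : z₁ ≫ d = (z₂ ≫ g) ≫ W.proj) (hf' : W.ev z₁ (z₂ ≫ g) h = f) :
    g = W.curry sq f :=
  (W.existsUnique sq f).choose_spec.2 g ⟨hg, hf'⟩

theorem comp_curry (sq : IsPullback z₁ z₂ d y) (f : Z ⟶ V) {Y' Z' : C}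
    {z₁' : Z' ⟶ A} {z₂' : Z' ⟶ Y'} {s : Y' ⟶ Y} {y' : Y' ⟶ X} (sq' : IsPullback z₁' z₂' d y')
    (t : Z' ⟶ Z) (f' : Z' ⟶ V) (hy : s ≫ y = y') (h₁ : t ≫ z₁ = z₁')
    (h₂ : t ≫ z₂ = z₂' ≫ s) (h : t ≫ f = f') : s ≫ W.curry sq f = W.curry sq' f' := by
  have e : z₁ ≫ d = (z₂ ≫ W.curry sq f) ≫ W.proj := by simp [sq.w]
  refine W.eq_curry _ _ _ (by simp [hy]) (by simp [hy, sq'.w]) ?_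
  have := W.comp_ev t _ _ e
  rw [W.ev_curry, h] at this
  rw [this]
  congr 1
  · exact h₁.symm
  · rw [← Category.assoc, ← Category.assoc, h₂]

end FibreExp

end Curry

/-! ### Types, terms and context extension -/

section Types

variable {C : Type u} [SmallCategory C] {D : MorphismProperty C} {Γ Δ : C}

/-- The type of a term. -/
abbrev TermIn.type (x : TermIn D Γ) : TypeIn D Γ := ⟨x.d, x.mem, x.a ≫ x.d⟩

namespace TypeIn

/-- Substitution into a type. -/
abbrev subst (A : TypeIn D Γ) (s : Δ ⟶ Γ) : TypeIn D Δ := ⟨A.d, A.mem, s ≫ A.b⟩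

/-- The term given by a map into the total object of a type. -/
abbrev term (A : TypeIn D Γ) (s : Γ ⟶ A.tot) : TermIn D Γ := ⟨A.d, A.mem, s⟩

theorem term_type {A : TypeIn D Γ} {s : Γ ⟶ A.tot} (h : s ≫ A.d = A.b) : (A.term s).type = A := by
  rw [TermIn.type, h]

theorem term_injective {tot base : C} {d : tot ⟶ base} {hd : D d} {s t : Γ ⟶ tot}
    (h : (⟨d, hd, s⟩ : TermIn D Γ) = ⟨d, hd, t⟩) : s = t := by
  cases h
  rfl

/-- Equality of types includes equality of the underlying `D`-maps, so a term of `A` is literally a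
map into the total object of `A`. -/
theorem exists_term {A : TypeIn D Γ} {x : TermIn D Γ} (h : x.type = A) :
    ∃ s : Γ ⟶ A.tot, s ≫ A.d = A.b ∧ A.term s = x := by
  subst h
  exact ⟨x.a, rfl, rfl⟩

/-- The section of a type given by one of its terms. -/
noncomputable def sect (A : TypeIn D Γ) (x : TermIn D Γ) (h : x.type = A) : Γ ⟶ A.tot :=
  (exists_term h).choose

theorem sect_d (A : TypeIn D Γ) (x : TermIn D Γ) (h : x.type = A) : A.sect x h ≫ A.d = A.b :=
  (exists_term h).choose_spec.1

theorem term_sect (A : TypeIn D Γ) (x : TermIn D Γ) (h : x.type = A) : A.term (A.sect x h) = x :=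
  (exists_term h).choose_spec.2

variable [D.HasPullbacks] (A : TypeIn D Γ)

theorem hasPullback : HasPullback A.d A.b := D.hasPullback A.b A.mem

/-- The extension of a context by a type. -/
noncomputable def ext : C :=
  haveI := A.hasPullback
  pullback A.d A.b

/-- The generic term over a context extension, as a map. -/
noncomputable def var : A.ext ⟶ A.tot :=
  haveI := A.hasPullback
  pullback.fst A.d A.b

/-- The projection from a context extension. -/
noncomputable def wk : A.ext ⟶ Γ :=
  haveI := A.hasPullback
  pullback.snd A.d A.b

theorem isPullback : IsPullback A.var A.wk A.d A.b :=
  haveI := A.hasPullback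
  IsPullback.of_hasPullback A.d A.b

theorem w : A.var ≫ A.d = A.wk ≫ A.b := A.isPullback.w

theorem wk_mem [D.IsStableUnderBaseChange] : D A.wk := D.of_isPullback A.isPullback A.mem

variable (D)

/-- The comprehension structure on `D₁ ⟶ D₀`. -/
noncomputable abbrev comprehension : Comprehension (typing D) where
  ext a := op (TypeIn.ext a)
  wk a := (TypeIn.wk a).op
  var a := (⟨a.d, a.mem, TypeIn.var a⟩ : TermIn D _)
  app_var a := congrArg (fun b => (⟨a.d, a.mem, b⟩ : TypeIn D _)) (TypeIn.w a)
  lift a σ b h := (a.isPullback.lift ((TypeIn.subst a σ.unop).sect b h) σ.unop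
    ((TypeIn.subst a σ.unop).sect_d b h)).op
  wk_lift a σ b h := Quiver.Hom.unop_inj (a.isPullback.lift_snd _ _ _)
  map_lift a σ b h := by
    refine Eq.trans ?_ ((TypeIn.subst a σ.unop).term_sect b h)
    exact congrArg (fun b => (⟨a.d, a.mem, b⟩ : TermIn D _)) (a.isPullback.lift_fst _ _ _)
  hom_ext {_ _ a _ _} h₁ h₂ := Quiver.Hom.unop_inj
    (a.isPullback.hom_ext (TypeIn.term_injective h₂) (congrArg Quiver.Hom.unop h₁))

variable {D}

/-- The action of a substitution on context extensions. -/
noncomputable def extMap (s : Δ ⟶ Γ) : (A.subst s).ext ⟶ A.ext :=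
  ((comprehension D).extMap (Γ := op Γ) s.op A).unop

@[simp]
theorem extMap_var (s : Δ ⟶ Γ) : A.extMap s ≫ A.var = (A.subst s).var :=
  term_injective ((comprehension D).map_extMap_var (Γ := op Γ) s.op A)

@[simp]
theorem extMap_wk (s : Δ ⟶ Γ) : A.extMap s ≫ A.wk = (A.subst s).wk ≫ s :=
  congrArg Quiver.Hom.unop ((comprehension D).wk_extMap (Γ := op Γ) s.op A)

@[simp]
theorem extMap_wk_assoc (s : Δ ⟶ Γ) {T : C} (k : Γ ⟶ T) :
    A.extMap s ≫ A.wk ≫ k = (A.subst s).wk ≫ s ≫ k := by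
  rw [← Category.assoc, extMap_wk, Category.assoc]

end TypeIn

end Types

/-! ### Universal families and their classifying maps -/

section Universe

variable {C : Type u} [SmallCategory C] {D : MorphismProperty C} [D.HasPullbacks]
  [D.IsStableUnderBaseChange] (hD : IsClosedClass D)

namespace IsClosedClass

/-- A chosen pushforward. -/
noncomputable def pushforward {A X Q : C} {d : A ⟶ X} (hd : D d) {q : Q ⟶ A} (hq : D q) :
    Pushforward D d q :=
  (hD.nonempty_pushforward hd hq).some

/-- A chosen exponential. -/
noncomputable def fibreExp {A X : C} {d : A ⟶ X} (hd : D d) (V : C) : FibreExp D d V :=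
  (hD.nonempty_fibreExp hd V).some

section Generic

variable {E U E' V : C} {d : E ⟶ U} (hd : D d) {d' : E' ⟶ V} (hd' : D d')

/-- The base type of the universal family of types `d'` over a type `d`. -/
noncomputable abbrev genericBase (V : C) : TypeIn D (hD.fibreExp hd V).obj :=
  ⟨d, hd, (hD.fibreExp hd V).proj⟩

/-- The universal family of types `d'` over a type `d`. -/
noncomputable abbrev genericFam : TypeIn D (hD.genericBase hd V).ext :=
  ⟨d', hd', (hD.fibreExp hd V).ev (hD.genericBase hd V).var (hD.genericBase hd V).wk
    (hD.genericBase hd V).w⟩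

theorem sigma_mem : D ((hD.genericFam hd hd').wk ≫ (hD.genericBase hd V).wk) :=
  hD.comp_mem _ _ (TypeIn.wk_mem _) (TypeIn.wk_mem _)

/-- The product of the universal family. -/
noncomputable abbrev genericProd :
    Pushforward D (hD.genericBase hd V).wk (hD.genericFam hd hd').wk :=
  hD.pushforward (TypeIn.wk_mem _) (TypeIn.wk_mem _)

end Generic

variable {Γ Δ : C} (A : TypeIn D Γ) (B : TypeIn D A.ext)

/-- The map classifying a family of types. -/
noncomputable def classify : Γ ⟶ (hD.fibreExp A.mem B.base).obj :=
  (hD.fibreExp A.mem B.base).curry A.isPullback B.b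

@[simp]
theorem classify_proj : hD.classify A B ≫ (hD.fibreExp A.mem B.base).proj = A.b :=
  (hD.fibreExp A.mem B.base).curry_proj _ _

/-- Both sides transpose the same map out of the extension of `Δ`. Since only the classifying map of
`sigma` and `pi` depends on the context, this is their strict stability. -/
theorem classify_subst (s : Δ ⟶ Γ) :
    hD.classify (A.subst s) (B.subst (A.extMap s)) = s ≫ hD.classify A B :=
  ((hD.fibreExp A.mem B.base).comp_curry A.isPullback B.b (A.subst s).isPullback (A.extMap s) _ rfl
    (A.extMap_var s) (A.extMap_wk s) rfl).symm

/-- The map of context extensions over `classify`. -/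
noncomputable def classifyExt : A.ext ⟶ (hD.genericBase A.mem B.base).ext :=
  (hD.genericBase A.mem B.base).isPullback.lift A.var (A.wk ≫ hD.classify A B) (by simp [A.w])

@[simp]
theorem classifyExt_var : hD.classifyExt A B ≫ (hD.genericBase A.mem B.base).var = A.var :=
  IsPullback.lift_fst _ _ _ _

@[simp]
theorem classifyExt_wk :
    hD.classifyExt A B ≫ (hD.genericBase A.mem B.base).wk = A.wk ≫ hD.classify A B :=
  IsPullback.lift_snd _ _ _ _

theorem isPullback_classifyExt : IsPullback (hD.classifyExt A B) A.wk
    (hD.genericBase A.mem B.base).wk (hD.classify A B) := by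
  refine IsPullback.of_right ?_ (hD.classifyExt_wk A B) (hD.genericBase A.mem B.base).isPullback
  rw [classifyExt_var, classify_proj]
  exact A.isPullback

/-- The triangle law for the exponential: `B` is the universal family restricted along
`classifyExt`, as an equality and not only up to isomorphism. -/
theorem classifyExt_fam : hD.classifyExt A B ≫ (hD.genericFam A.mem B.mem).b = B.b := by
  have h : A.var ≫ A.d =
      (A.wk ≫ hD.classify A B) ≫ (hD.fibreExp A.mem B.base).proj := by simp [A.w]
  refine ((hD.fibreExp A.mem B.base).comp_ev _ _ _ _).trans ?_
  refine Eq.trans ?_ ((hD.fibreExp A.mem B.base).ev_curry A.isPullback B.b h)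
  congr 1
  · simp
  · simp [classify]

theorem classifyExt_subst (s : Δ ⟶ Γ) :
    hD.classifyExt (A.subst s) (B.subst (A.extMap s)) = A.extMap s ≫ hD.classifyExt A B := by
  apply (hD.genericBase A.mem B.base).isPullback.hom_ext
  · refine (hD.classifyExt_var (A.subst s) (B.subst (A.extMap s))).trans ?_
    simp
  · refine (hD.classifyExt_wk (A.subst s) (B.subst (A.extMap s))).trans ?_
    rw [classify_subst]
    simp

/-- The sum of a family of types. -/
noncomputable abbrev sigma : TypeIn D Γ := ⟨_, hD.sigma_mem A.mem B.mem, hD.classify A B⟩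

/-- The product of a family of types. -/
noncomputable abbrev pi : TypeIn D Γ :=
  ⟨_, (hD.genericProd A.mem B.mem).mem, hD.classify A B⟩

end IsClosedClass

end Universe

/-! ### Elements of the polynomial functor of `typing D` -/

section Elements

variable {C : Type u} [SmallCategory C] {D : MorphismProperty C} [D.HasPullbacks]

theorem exists_elt_typePsh {Γ : Cᵒᵖ} (y : PolyElt (typing D) (typePsh D) Γ) :
    ∃ (A : TypeIn D Γ.unop) (B : TypeIn D A.ext),
      y = (TypeIn.comprehension D).elt (X := typePsh D) A B :=
  (TypeIn.comprehension D).exists_elt y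

theorem exists_elt_termPsh {Γ : Cᵒᵖ} (y : PolyElt (typing D) (termPsh D) Γ) :
    ∃ (A : TypeIn D Γ.unop) (e : TermIn D A.ext),
      y = (TypeIn.comprehension D).elt (X := termPsh D) A e :=
  (TypeIn.comprehension D).exists_elt y

theorem map_typing_elt {Γ : Cᵒᵖ} (A : TypeIn D Γ.unop) (e : TermIn D A.ext) :
    ((poly (typing D)).map (typing D)).app Γ ((TypeIn.comprehension D).elt (X := termPsh D) A e) =
      (TypeIn.comprehension D).elt (X := typePsh D) A e.type :=
  (TypeIn.comprehension D).postcomp_elt (typing D) A e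

end Elements

/-! ### Dependent sums and products -/

section SigmaPi

variable {C : Type u} [SmallCategory C] {D : MorphismProperty C} [D.HasPullbacks]
  [D.IsStableUnderBaseChange] (hD : IsClosedClass D)

/-- Substitution into a term. -/
abbrev TermIn.subst {Γ Δ : C} (x : TermIn D Γ) (s : Δ ⟶ Γ) : TermIn D Δ := ⟨x.d, x.mem, s ≫ x.a⟩

namespace IsClosedClass

section Sigma

variable {Γ Δ : C} (A : TypeIn D Γ) (B : TypeIn D A.ext)

/-- `m` is the pair of the terms `a` and `b`. -/
def IsPairing (a b : TermIn D Γ) (m : Γ ⟶ (hD.genericFam A.mem B.mem).ext) : Prop :=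
  m ≫ (hD.genericFam A.mem B.mem).wk ≫ (hD.genericBase A.mem B.base).wk = hD.classify A B ∧
    (⟨A.d, A.mem, m ≫ (hD.genericFam A.mem B.mem).wk ≫ (hD.genericBase A.mem B.base).var⟩ :
      TermIn D Γ) = a ∧
    (⟨B.d, B.mem, m ≫ (hD.genericFam A.mem B.mem).var⟩ : TermIn D Γ) = b

variable {hD A B} {a b : TermIn D Γ} {m m' : Γ ⟶ (hD.genericFam A.mem B.mem).ext}

/-- The generic total object is an iterated pullback, so a map into it is fixed by its three
components. Uniqueness makes the choice of pairs natural. -/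
theorem IsPairing.unique (h : hD.IsPairing A B a b m) (h' : hD.IsPairing A B a b m') : m = m' := by
  obtain ⟨h₁, h₂, h₃⟩ := h
  obtain ⟨h₁', h₂', h₃'⟩ := h'
  refine (hD.genericFam A.mem B.mem).isPullback.hom_ext
    (TypeIn.term_injective (h₃.trans h₃'.symm))
    ((hD.genericBase A.mem B.base).isPullback.hom_ext ?_ ?_)
  · simpa using TypeIn.term_injective (h₂.trans h₂'.symm)
  · simpa using h₁.trans h₁'.symm

theorem IsPairing.subst (h : hD.IsPairing A B a b m) (s : Δ ⟶ Γ) :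
    hD.IsPairing (A.subst s) (B.subst (A.extMap s)) (a.subst s) (b.subst s) (s ≫ m) := by
  obtain ⟨h₁, rfl, rfl⟩ := h
  refine ⟨?_, ?_, ?_⟩
  · rw [classify_subst, ← h₁, Category.assoc]
  · simp only [TermIn.subst, Category.assoc]
  · simp only [TermIn.subst, Category.assoc]

variable (hD)

theorem exists_isPairing (l : Γ ⟶ A.ext) (hl : l ≫ A.wk = 𝟙 Γ)
    (ha : (⟨A.d, A.mem, l ≫ A.var⟩ : TermIn D Γ) = a) (hb : b.type = B.subst l) :
    ∃ m, hD.IsPairing A B a b m := by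
  obtain ⟨t, ht, rfl⟩ := TypeIn.exists_term hb
  have h₂ := (hD.genericFam A.mem B.mem).isPullback.lift_snd t (l ≫ hD.classifyExt A B) (by
    rw [Category.assoc, classifyExt_fam]
    exact ht)
  refine ⟨(hD.genericFam A.mem B.mem).isPullback.lift t (l ≫ hD.classifyExt A B) (by
    rw [Category.assoc, classifyExt_fam]
    exact ht), ?_, ?_, ?_⟩
  · rw [← Category.assoc, h₂, Category.assoc, classifyExt_wk, ← Category.assoc, hl,
      Category.id_comp]
  · rw [← Category.assoc, h₂, Category.assoc, classifyExt_var, ha]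
  · rw [IsPullback.lift_fst]

/-- Splits a term `m` of the sum: its first projection gives the section `l` of the extension by
`A`, and its last component is a term of `B` restricted along `l`. -/
theorem isPairing_of_comp (h : m ≫ (hD.genericFam A.mem B.mem).wk ≫
      (hD.genericBase A.mem B.base).wk = hD.classify A B) :
    ∃ l : Γ ⟶ A.ext, l ≫ A.wk = 𝟙 Γ ∧
      l ≫ A.var = m ≫ (hD.genericFam A.mem B.mem).wk ≫ (hD.genericBase A.mem B.base).var ∧
      (m ≫ (hD.genericFam A.mem B.mem).var) ≫ B.d = l ≫ B.b := by
  have h' := congrArg (· ≫ (hD.fibreExp A.mem B.base).proj) h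
  simp only [Category.assoc, classify_proj] at h'
  let l : Γ ⟶ A.ext := A.isPullback.lift
    (m ≫ (hD.genericFam A.mem B.mem).wk ≫ (hD.genericBase A.mem B.base).var) (𝟙 Γ) (by
      simp only [Category.assoc, Category.id_comp]
      rw [← h']
      exact congrArg (fun k => m ≫ (hD.genericFam A.mem B.mem).wk ≫ k)
        (hD.genericBase A.mem B.base).w)
  have hl₁ : l ≫ A.var = _ := A.isPullback.lift_fst _ _ _
  have hl₂ : l ≫ A.wk = _ := A.isPullback.lift_snd _ _ _
  refine ⟨l, hl₂, hl₁, ?_⟩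
  have e : l ≫ hD.classifyExt A B = m ≫ (hD.genericFam A.mem B.mem).wk := by
    apply (hD.genericBase A.mem B.base).isPullback.hom_ext
    · simp only [Category.assoc, classifyExt_var, hl₁]
    · simp only [Category.assoc, classifyExt_wk, h]
      rw [← Category.assoc, hl₂, Category.id_comp]
  rw [← hD.classifyExt_fam A B, ← Category.assoc, e, Category.assoc, Category.assoc]
  exact congrArg (m ≫ ·) (hD.genericFam A.mem B.mem).w

end Sigma

/-- The family over the context extension underlying an element of `P_π(D₀)`. -/
noncomputable abbrev famGen {Γ : Cᵒᵖ} (x : PolyElt (typing D) (typePsh D) Γ) :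
    TypeIn D (TypeIn.ext (D := D) x.base) :=
  (TypeIn.comprehension D).gen x x.base rfl

theorem exists_pairTerm {Γ : Cᵒᵖ} (x : PairElt (typing D) Γ) :
    ∃ m, hD.IsPairing x.fam.base (famGen x.fam) x.a x.b m := by
  refine hD.exists_isPairing
    (((TypeIn.comprehension D).lift x.fam.base (𝟙 Γ) x.a x.ha).unop)
    (congrArg Quiver.Hom.unop ((TypeIn.comprehension D).wk_lift x.fam.base (𝟙 Γ) x.a x.ha))
    ((TypeIn.comprehension D).map_lift x.fam.base (𝟙 Γ) x.a x.ha)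
    (x.hb.trans ?_)
  exact (TypeIn.comprehension D).val_eq x.fam _ _ _

/-- The pair of two terms. -/
noncomputable def pairTerm {Γ : Cᵒᵖ} (x : PairElt (typing D) Γ) : TermIn D Γ.unop :=
  ⟨_, hD.sigma_mem (TypeIn.mem x.fam.base) (famGen x.fam).mem, (hD.exists_pairTerm x).choose⟩

theorem pairTerm_eq {Γ : Cᵒᵖ} (x : PairElt (typing D) Γ) {A : TypeIn D Γ.unop}
    {B : TypeIn D A.ext} (h : x.fam = (TypeIn.comprehension D).elt (X := typePsh D) A B)
    {m : Γ.unop ⟶ (hD.genericFam A.mem B.mem).ext} (hm : hD.IsPairing A B x.a x.b m) :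
    hD.pairTerm x = (hD.sigma A B).term m := by
  obtain ⟨fam, a, ha, b, hb⟩ := x
  obtain rfl : fam = _ := h
  have e : famGen ((TypeIn.comprehension D).elt (X := typePsh D) A B) = B :=
    (TypeIn.comprehension D).gen_elt (X := typePsh D) A B
  -- The family read off from `elt A B` equals `B` only propositionally, and the codomain of the
  -- pair depends on it; hence the generalization to `B'`.
  have key : ∀ (B' : TypeIn D A.ext), B' = B → ∀ m' : Γ.unop ⟶ (hD.genericFam A.mem B'.mem).ext,
      hD.IsPairing A B' a b m' → (hD.sigma A B').term m' = (hD.sigma A B).term m := by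
    rintro _ rfl m' hm'
    rw [hm'.unique hm]
  exact key _ e _ (hD.exists_pairTerm _).choose_spec

/-- The map `pair`. -/
noncomputable def pair : pairPsh (typing D) ⟶ termPsh D where
  app Γ := ↾fun x => hD.pairTerm x
  naturality Γ Γ' s := by
    ext x
    obtain ⟨m, hm⟩ := hD.exists_pairTerm x
    have h : x.fam = (TypeIn.comprehension D).elt x.fam.base (famGen x.fam) :=
      ((TypeIn.comprehension D).elt_gen _ _ _).symm
    refine (hD.pairTerm_eq (x.reindex s) ?_ (hm.subst s.unop)).trans ?_
    · exact (congrArg (PolyElt.reindex s) h).trans ((TypeIn.comprehension D).reindex_elt s _ _)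
    · exact (congrArg (fun t : TermIn D _ => t.subst s.unop) (hD.pairTerm_eq x h hm)).symm

/-- The map `Σ`. -/
noncomputable def sigmaMap : (poly (typing D)).obj (typePsh D) ⟶ typePsh D :=
  (TypeIn.comprehension D).polyDesc (fun A B => hD.sigma A B) (fun s A B =>
    congrArg (fun b => (⟨_, hD.sigma_mem (TypeIn.mem A) (TypeIn.mem B), b⟩ : TypeIn D _))
      (hD.classify_subst A B s.unop))

theorem sigmaMap_elt {Γ : Cᵒᵖ} (A : TypeIn D Γ.unop) (B : TypeIn D A.ext) :
    hD.sigmaMap.app Γ ((TypeIn.comprehension D).elt (X := typePsh D) A B) = hD.sigma A B :=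
  congrArg (hD.sigma A) ((TypeIn.comprehension D).gen_elt (X := typePsh D) A B)

theorem modelsSigma (hD : IsClosedClass D) : ModelsSigma (typing D) := by
  refine ⟨hD.pair, hD.sigmaMap, isPullback_of_elements ?_ ?_ ?_⟩
  · refine NatTrans.ext (funext fun Γ => ConcreteCategory.hom_ext _ _ fun x => ?_)
    exact congrArg (fun b => (⟨_, hD.sigma_mem (TypeIn.mem x.fam.base) (famGen x.fam).mem, b⟩ :
      TypeIn D _)) (hD.exists_pairTerm x).choose_spec.1
  · intro Γ x y h₁ h₂
    change hD.pairTerm x = hD.pairTerm y at h₁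
    change x.fam = y.fam at h₂
    obtain ⟨m, hm⟩ := hD.exists_pairTerm x
    have hy := hD.exists_pairTerm y
    have hx : x.fam = (TypeIn.comprehension D).elt x.fam.base (famGen x.fam) :=
      ((TypeIn.comprehension D).elt_gen _ _ _).symm
    -- Identifying the families first puts both pairs in the same generic total object.
    rw [← h₂] at hy
    obtain ⟨n, hn⟩ := hy
    have e : m = n := TypeIn.term_injective
      ((hD.pairTerm_eq _ hx hm).symm.trans (h₁.trans (hD.pairTerm_eq _ (h₂.symm.trans hx) hn)))
    rw [← e] at hn
    exact PairElt.ext' h₂ (hm.2.1.symm.trans hn.2.1) (hm.2.2.symm.trans hn.2.2)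
  · intro Γ t y h
    obtain ⟨A, B, rfl⟩ := exists_elt_typePsh y
    obtain ⟨m, hm, rfl⟩ := TypeIn.exists_term (h.trans (hD.sigmaMap_elt A B))
    obtain ⟨l, hl₁, hl₂, hl₃⟩ := hD.isPairing_of_comp hm
    let a : TermIn D Γ.unop := ⟨A.d, A.mem, l ≫ A.var⟩
    have ha : (typing D).app Γ a = (typePsh D).map (𝟙 Γ) A := by
      have : (l ≫ A.var) ≫ A.d = 𝟙 _ ≫ A.b := by rw [Category.assoc, A.w, ← Category.assoc, hl₁]
      exact congrArg (fun b => (⟨A.d, A.mem, b⟩ : TypeIn D _)) this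
    have hl : (TypeIn.comprehension D).lift A (𝟙 Γ) a ha = l.op :=
      (TypeIn.comprehension D).hom_ext
        (((TypeIn.comprehension D).wk_lift A (𝟙 Γ) a ha).trans (congrArg Quiver.Hom.op hl₁.symm))
        ((TypeIn.comprehension D).map_lift A (𝟙 Γ) a ha)
    let b : TermIn D Γ.unop := ⟨B.d, B.mem, m ≫ (hD.genericFam _ _).var⟩
    let x : PairElt (typing D) Γ :=
      { fam := (TypeIn.comprehension D).elt A B
        a := a
        ha := ha
        b := b
        hb := by
          change b.type = B.subst ((TypeIn.comprehension D).lift A (𝟙 Γ) a ha).unop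
          rw [hl]
          exact congrArg (fun b => (⟨B.d, B.mem, b⟩ : TypeIn D _)) hl₃ }
    refine ⟨x, hD.pairTerm_eq x rfl ⟨hm, ?_, rfl⟩, rfl⟩
    rw [← hl₂]

/-! ### Abstraction and its inverse -/

section Pi

variable {Γ Δ : C} (A : TypeIn D Γ) (e : TermIn D A.ext)

/-- The map of total objects classifying a term of a family. -/
noncomputable def classifyTerm : A.ext ⟶ (hD.genericFam A.mem e.mem).ext :=
  (hD.genericFam A.mem e.mem).isPullback.lift e.a (hD.classifyExt A e.type)
    (hD.classifyExt_fam A e.type).symm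

theorem classifyTerm_var :
    hD.classifyTerm A e ≫ (hD.genericFam A.mem e.mem).var = e.a := IsPullback.lift_fst _ _ _ _

theorem classifyTerm_wk : hD.classifyTerm A e ≫ (hD.genericFam A.mem e.mem).wk =
    hD.classifyExt A e.type := IsPullback.lift_snd _ _ _ _

/-- Only the classifying map varies, so the codomain stays fixed. This absorbs equations such as `(s
≫ a) ≫ d = s ≫ a ≫ d`, which are not definitional. -/
theorem classify_congr {tot base : C} {d : tot ⟶ base} (hd : D d) {b b' : A.ext ⟶ base}
    (h : b = b') : hD.classify A ⟨d, hd, b⟩ = hD.classify A ⟨d, hd, b'⟩ := by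
  rw [h]

theorem classifyExt_congr {tot base : C} {d : tot ⟶ base} (hd : D d) {b b' : A.ext ⟶ base}
    (h : b = b') : hD.classifyExt A ⟨d, hd, b⟩ = hD.classifyExt A ⟨d, hd, b'⟩ := by
  subst h
  rfl

theorem classify_subst_type (s : Δ ⟶ Γ) :
    hD.classify (A.subst s) (e.subst (A.extMap s)).type = s ≫ hD.classify A e.type :=
  (hD.classify_congr (A.subst s) e.mem (Category.assoc (A.extMap s) e.a e.d)).trans
    (hD.classify_subst A e.type s)

theorem classifyExt_subst_type (s : Δ ⟶ Γ) :
    hD.classifyExt (A.subst s) (e.subst (A.extMap s)).type =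
      A.extMap s ≫ hD.classifyExt A e.type :=
  (hD.classifyExt_congr (A.subst s) e.mem (Category.assoc (A.extMap s) e.a e.d)).trans
    (hD.classifyExt_subst A e.type s)

theorem classifyTerm_subst (s : Δ ⟶ Γ) :
    hD.classifyTerm (A.subst s) (e.subst (A.extMap s)) = A.extMap s ≫ hD.classifyTerm A e := by
  apply (hD.genericFam A.mem e.mem).isPullback.hom_ext
  · refine (hD.classifyTerm_var (A.subst s) (e.subst (A.extMap s))).trans ?_
    rw [Category.assoc, classifyTerm_var]
  · refine (hD.classifyTerm_wk (A.subst s) (e.subst (A.extMap s))).trans ?_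
    rw [Category.assoc, classifyTerm_wk]
    exact hD.classifyExt_subst_type A e s

/-- The abstraction of a term, as a map. -/
noncomputable def lamHom : Γ ⟶ (hD.genericProd A.mem e.mem).obj :=
  (hD.genericProd A.mem e.mem).curry (hD.isPullback_classifyExt A e.type) (hD.classifyTerm A e)
    (hD.classifyTerm_wk A e)

@[simp]
theorem lamHom_proj : hD.lamHom A e ≫ (hD.genericProd A.mem e.mem).proj = hD.classify A e.type :=
  Pushforward.curry_proj _ _ _ _

theorem lamHom_subst (s : Δ ⟶ Γ) :
    hD.lamHom (A.subst s) (e.subst (A.extMap s)) = s ≫ hD.lamHom A e := by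
  refine ((hD.genericProd A.mem e.mem).comp_curry
    (hD.isPullback_classifyExt A e.type) (hD.classifyTerm A e) (hD.classifyTerm_wk A e)
    (hD.isPullback_classifyExt (A.subst s) (e.subst (A.extMap s)).type) (A.extMap s) _
    (hD.classifyTerm_wk (A.subst s) (e.subst (A.extMap s))) (hD.classify_subst_type A e s).symm
    (hD.classifyExt_subst_type A e s).symm (A.extMap_wk s)
    (hD.classifyTerm_subst A e s).symm).symm

/-- The beta rule: evaluating the abstraction at the generic argument recovers the term, whence
injectivity of `lamHom`. -/
theorem classifyTerm_eq_ev : hD.classifyTerm A e =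
    (hD.genericProd A.mem e.mem).ev (hD.classifyExt A e.type) (A.wk ≫ hD.lamHom A e)
      (by rw [Category.assoc, lamHom_proj, classifyExt_wk]) :=
  (Pushforward.ev_curry _ _ _ _ _).symm

theorem eq_of_lamHom_eq {tot base : C} {d : tot ⟶ base} (hd : D d) {a b : A.ext ⟶ tot}
    (h : a ≫ d = b ≫ d) (h' : hD.lamHom A ⟨d, hd, a⟩ = hD.lamHom A ⟨d, hd, b⟩) : a = b := by
  have key : hD.classifyTerm A ⟨d, hd, a⟩ = hD.classifyTerm A ⟨d, hd, b⟩ := by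
    rw [hD.classifyTerm_eq_ev A ⟨d, hd, a⟩, hD.classifyTerm_eq_ev A ⟨d, hd, b⟩]
    congr 1
    · exact hD.classifyExt_congr A hd h
    · rw [h']
  exact (hD.classifyTerm_var A ⟨d, hd, a⟩).symm.trans
    ((congrArg (· ≫ (hD.genericFam A.mem hd).var) key).trans (hD.classifyTerm_var A ⟨d, hd, b⟩))

/-- The eta rule: `m` is the abstraction of its evaluation at the generic argument, by uniqueness of
transposes. -/
theorem exists_lamHom_eq (B : TypeIn D A.ext) (m : Γ ⟶ (hD.genericProd A.mem B.mem).obj)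
    (hm : m ≫ (hD.genericProd A.mem B.mem).proj = hD.classify A B) :
    ∃ a : A.ext ⟶ B.tot, a ≫ B.d = B.b ∧ hD.lamHom A ⟨B.d, B.mem, a⟩ = m := by
  have h : hD.classifyExt A B ≫ (hD.genericBase A.mem B.base).wk =
      (A.wk ≫ m) ≫ (hD.genericProd A.mem B.mem).proj := by simp [hm]
  let f := (hD.genericProd A.mem B.mem).ev (hD.classifyExt A B) (A.wk ≫ m) h
  have hf : f ≫ (hD.genericFam A.mem B.mem).wk = hD.classifyExt A B := Pushforward.ev_comp _ _ _ _
  have ha : (f ≫ (hD.genericFam A.mem B.mem).var) ≫ B.d = B.b := by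
    rw [← hD.classifyExt_fam A B, ← hf, Category.assoc, Category.assoc]
    exact congrArg (f ≫ ·) (hD.genericFam A.mem B.mem).w
  -- `lamHom` recomputes its family from the term as `a ≫ B.d`, which equals `B.b` only
  -- propositionally.
  have h₁ : hD.classify A (⟨B.d, B.mem, (f ≫ (hD.genericFam A.mem B.mem).var) ≫ B.d⟩) =
      hD.classify A B := hD.classify_congr A B.mem ha
  have h₂ : hD.classifyExt A (⟨B.d, B.mem, (f ≫ (hD.genericFam A.mem B.mem).var) ≫ B.d⟩) =
      hD.classifyExt A B := hD.classifyExt_congr A B.mem ha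
  refine ⟨f ≫ (hD.genericFam A.mem B.mem).var, ha, ?_⟩
  refine (Pushforward.eq_curry _ _ _ _ m (hm.trans h₁.symm) (by rw [h₂, h]) ?_).symm
  apply (hD.genericFam A.mem B.mem).isPullback.hom_ext
  · refine Eq.trans ?_ (hD.classifyTerm_var A ⟨B.d, B.mem, _⟩).symm
    congr 1
    simp only [f]
    congr 1
  · rw [Pushforward.ev_comp]
    exact (hD.classifyTerm_wk A ⟨B.d, B.mem, _⟩).symm

end Pi

/-- The map `λ`. -/
noncomputable def lamMap : (poly (typing D)).obj (termPsh D) ⟶ termPsh D :=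
  (TypeIn.comprehension D).polyDesc
    (fun {Γ} A e => (⟨_, (hD.genericProd (TypeIn.mem A) (TermIn.mem e)).mem, hD.lamHom A e⟩ :
      TermIn D Γ.unop))
    (fun s A e => congrArg
      (fun b => (⟨_, (hD.genericProd (TypeIn.mem A) (TermIn.mem e)).mem, b⟩ : TermIn D _))
      (hD.lamHom_subst A e s.unop))

/-- The map `Π`. -/
noncomputable def piMap : (poly (typing D)).obj (typePsh D) ⟶ typePsh D :=
  (TypeIn.comprehension D).polyDesc (fun A B => hD.pi A B) (fun s A B =>
    congrArg
      (fun b => (⟨_, (hD.genericProd (TypeIn.mem A) (TypeIn.mem B)).mem, b⟩ : TypeIn D _))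
      (hD.classify_subst A B s.unop))

theorem piMap_elt {Γ : Cᵒᵖ} (A : TypeIn D Γ.unop) (B : TypeIn D A.ext) :
    hD.piMap.app Γ ((TypeIn.comprehension D).elt (X := typePsh D) A B) = hD.pi A B :=
  congrArg (hD.pi A) ((TypeIn.comprehension D).gen_elt (X := typePsh D) A B)

theorem lamMap_elt {Γ : Cᵒᵖ} (A : TypeIn D Γ.unop) (e : TermIn D A.ext) :
    hD.lamMap.app Γ ((TypeIn.comprehension D).elt (X := termPsh D) A e) =
      (hD.pi A e.type).term (hD.lamHom A e) :=
  congrArg (fun e : TermIn D A.ext => (hD.pi A e.type).term (hD.lamHom A e))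
    ((TypeIn.comprehension D).gen_elt (X := termPsh D) A e)

theorem modelsPi (hD : IsClosedClass D) : ModelsPi (typing D) := by
  refine ⟨hD.lamMap, hD.piMap, isPullback_of_elements ?_ ?_ ?_⟩
  · refine NatTrans.ext (funext fun Γ => ConcreteCategory.hom_ext _ _ fun x => ?_)
    obtain ⟨A, e, rfl⟩ := exists_elt_termPsh x
    change (typing D).app Γ (hD.lamMap.app Γ _) =
      hD.piMap.app Γ (((poly (typing D)).map (typing D)).app Γ _)
    rw [map_typing_elt, lamMap_elt, piMap_elt]
    exact TypeIn.term_type (hD.lamHom_proj A e)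
  · intro Γ x y h₁ h₂
    obtain ⟨A, e, rfl⟩ := exists_elt_termPsh x
    obtain ⟨A', e', rfl⟩ := exists_elt_termPsh y
    rw [map_typing_elt, map_typing_elt] at h₂
    obtain rfl : A = A' := congrArg PolyElt.base h₂
    have h := (TypeIn.comprehension D).elt_injective h₂
    obtain ⟨t, ht, rfl⟩ := TypeIn.exists_term h
    rw [lamMap_elt, lamMap_elt] at h₁
    obtain rfl := hD.eq_of_lamHom_eq A e'.mem ht (TypeIn.term_injective h₁)
    rfl
  · intro Γ t y h
    obtain ⟨A, B, rfl⟩ := exists_elt_typePsh y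
    obtain ⟨m, hm, rfl⟩ := TypeIn.exists_term (h.trans (hD.piMap_elt A B))
    obtain ⟨a, ha, rfl⟩ := hD.exists_lamHom_eq A B m hm
    refine ⟨(TypeIn.comprehension D).elt (X := termPsh D) A (B.term a), hD.lamMap_elt A _, ?_⟩
    rw [map_typing_elt, TypeIn.term_type ha]

end IsClosedClass

end SigmaPi

/-! ### Maps between context extensions -/

section ContextMaps

variable {C : Type u} [SmallCategory C] {D : MorphismProperty C} [D.HasPullbacks] {Γ Δ Θ : C}

namespace TypeIn

variable (A : TypeIn D Γ)

/-- The map of context extensions over a map of contexts compatible with the type. -/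
noncomputable def extOver {b : Δ ⟶ A.base} (k : Γ ⟶ Δ) (h : k ≫ b = A.b) :
    A.ext ⟶ (⟨A.d, A.mem, b⟩ : TypeIn D Δ).ext :=
  (⟨A.d, A.mem, b⟩ : TypeIn D Δ).isPullback.lift A.var (A.wk ≫ k) (by
    rw [A.w, Category.assoc, h])

section

variable {b : Δ ⟶ A.base} (k : Γ ⟶ Δ) (h : k ≫ b = A.b)

theorem extOver_var : A.extOver k h ≫ (⟨A.d, A.mem, b⟩ : TypeIn D Δ).var = A.var :=
  IsPullback.lift_fst _ _ _ _

theorem extOver_wk : A.extOver k h ≫ (⟨A.d, A.mem, b⟩ : TypeIn D Δ).wk = A.wk ≫ k :=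
  IsPullback.lift_snd _ _ _ _

theorem isPullback_extOver :
    IsPullback (A.extOver k h) A.wk (⟨A.d, A.mem, b⟩ : TypeIn D Δ).wk k := by
  refine IsPullback.of_right ?_ (A.extOver_wk k h) (⟨A.d, A.mem, b⟩ : TypeIn D Δ).isPullback
  rw [extOver_var]
  change IsPullback A.var A.wk A.d (k ≫ b)
  rw [h]
  exact A.isPullback

theorem extMap_extOver (s : Θ ⟶ Γ) :
    A.extMap s ≫ A.extOver k h =
      (A.subst s).extOver (s ≫ k) (by rw [Category.assoc, h]) := by
  apply (⟨A.d, A.mem, b⟩ : TypeIn D Δ).isPullback.hom_ext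
  · rw [Category.assoc, extOver_var, extMap_var]
    exact ((A.subst s).extOver_var (b := b) _ _).symm
  · rw [Category.assoc, extOver_wk, extMap_wk_assoc]
    exact ((A.subst s).extOver_wk (b := b) _ _).symm

theorem extOver_extOver {b' : Θ ⟶ A.base} (k' : Δ ⟶ Θ) (h' : k' ≫ b' = b) (k'' : Γ ⟶ Θ)
    (hk : k ≫ k' = k'') :
    A.extOver k h ≫ (⟨A.d, A.mem, b⟩ : TypeIn D Δ).extOver k' h' =
      A.extOver k'' (by rw [← hk, Category.assoc, h', h]) := by
  subst hk
  apply (⟨A.d, A.mem, b'⟩ : TypeIn D Θ).isPullback.hom_ext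
  · rw [Category.assoc, extOver_var, extOver_var, extOver_var]
  · rw [Category.assoc, extOver_wk, extOver_wk, ← Category.assoc, extOver_wk, Category.assoc]

end

section Total

variable {E U I : C} {d : E ⟶ U} (hd : D d) {i : I ⟶ U} (hi : D i) (r : E ⟶ I) (w : r ≫ i = d)
  (b : Γ ⟶ U)

/-- The map of context extensions induced by a map of types. -/
noncomputable def total : (⟨d, hd, b⟩ : TypeIn D Γ).ext ⟶ (⟨i, hi, b⟩ : TypeIn D Γ).ext :=
  (⟨i, hi, b⟩ : TypeIn D Γ).isPullback.lift ((⟨d, hd, b⟩ : TypeIn D Γ).var ≫ r)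
    (⟨d, hd, b⟩ : TypeIn D Γ).wk (by
      rw [Category.assoc, w]
      exact (⟨d, hd, b⟩ : TypeIn D Γ).w)

theorem total_var : total hd hi r w b ≫ (⟨i, hi, b⟩ : TypeIn D Γ).var =
    (⟨d, hd, b⟩ : TypeIn D Γ).var ≫ r := IsPullback.lift_fst _ _ _ _

theorem total_wk : total hd hi r w b ≫ (⟨i, hi, b⟩ : TypeIn D Γ).wk =
    (⟨d, hd, b⟩ : TypeIn D Γ).wk := IsPullback.lift_snd _ _ _ _

/-- Pullback pasting: `total` is the base change of `r` along `var`, the form to which the Frobenius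
property applies. -/
theorem isPullback_total : IsPullback (total hd hi r w b) (⟨d, hd, b⟩ : TypeIn D Γ).var
    (⟨i, hi, b⟩ : TypeIn D Γ).var r := by
  refine (IsPullback.of_bot ?_ (total_var hd hi r w b).symm
    (⟨i, hi, b⟩ : TypeIn D Γ).isPullback).flip
  rw [total_wk]
  subst w
  exact (⟨r ≫ i, hd, b⟩ : TypeIn D Γ).isPullback

theorem total_extOver {b' : Δ ⟶ U} (k : Γ ⟶ Δ) (h : k ≫ b' = b) :
    total hd hi r w b ≫ (⟨i, hi, b⟩ : TypeIn D Γ).extOver k h =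
      (⟨d, hd, b⟩ : TypeIn D Γ).extOver k h ≫ total hd hi r w b' := by
  apply (⟨i, hi, b'⟩ : TypeIn D Δ).isPullback.hom_ext
  · rw [Category.assoc, Category.assoc, total_var]
    refine (congrArg (total hd hi r w b ≫ ·)
      ((⟨i, hi, b⟩ : TypeIn D Γ).extOver_var k h)).trans ?_
    rw [total_var, ← Category.assoc]
    exact congrArg (· ≫ r) ((⟨d, hd, b⟩ : TypeIn D Γ).extOver_var k h).symm
  · rw [Category.assoc, Category.assoc, total_wk]
    refine (congrArg (total hd hi r w b ≫ ·)
      ((⟨i, hi, b⟩ : TypeIn D Γ).extOver_wk k h)).trans ?_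
    rw [← Category.assoc, total_wk]
    exact ((⟨d, hd, b⟩ : TypeIn D Γ).extOver_wk k h).symm

end Total

end TypeIn

end ContextMaps

/-! ### The universal lifting problem and natural fillers -/

section UniversalLifting

variable {C : Type u} [SmallCategory C] {D : MorphismProperty C} [D.HasPullbacks]
  [D.IsStableUnderBaseChange] (hD : IsClosedClass D) {E U I E' V : C} {d : E ⟶ U} (hd : D d)
  {i : I ⟶ U} (hi : D i) (r : E ⟶ I) (w : r ≫ i = d) {d' : E' ⟶ V} (hd' : D d')

namespace IsClosedClass

/-- The context `E` pulled back to the object classifying maps from `I` to `V`. -/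
noncomputable abbrev liftBase (V : C) : TypeIn D (hD.fibreExp hi V).obj :=
  ⟨d, hd, (hD.fibreExp hi V).proj⟩

/-- The restriction of the universal family over `I` along `r`. -/
noncomputable abbrev liftFam : TypeIn D (hD.liftBase hd hi V).ext :=
  (hD.genericFam hi hd').subst (TypeIn.total hd hi r w (hD.fibreExp hi V).proj)

/-- The object classifying lifting problems of `r` against `d'`. -/
noncomputable abbrev liftProblems :
    Pushforward D (hD.liftBase hd hi V).wk (hD.liftFam hd hi r w hd').wk :=
  hD.pushforward (TypeIn.wk_mem _) (TypeIn.wk_mem _)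

/-- The projection of the object of lifting problems to `U`. -/
noncomputable abbrev liftProj : (hD.liftProblems hd hi r w hd').obj ⟶ U :=
  (hD.liftProblems hd hi r w hd').proj ≫ (hD.fibreExp hi V).proj

theorem liftProj_mem : D (hD.liftProj hd hi r w hd') :=
  hD.comp_mem _ _ (Pushforward.mem _) (FibreExp.mem _)

/-- The top of the universal lifting problem. -/
noncomputable def univTop : (⟨d, hd, hD.liftProj hd hi r w hd'⟩ : TypeIn D _).ext ⟶ E' :=
  (hD.liftProblems hd hi r w hd').ev
    (TypeIn.extOver ⟨d, hd, hD.liftProj hd hi r w hd'⟩ (hD.liftProblems hd hi r w hd').proj rfl)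
    (TypeIn.wk _) (TypeIn.extOver_wk _ _ _) ≫ (hD.liftFam hd hi r w hd').var

/-- The bottom of the universal lifting problem. -/
noncomputable def univBot : (⟨i, hi, hD.liftProj hd hi r w hd'⟩ : TypeIn D _).ext ⟶ V :=
  TypeIn.extOver ⟨i, hi, hD.liftProj hd hi r w hd'⟩ (hD.liftProblems hd hi r w hd').proj rfl ≫
    (hD.genericFam hi hd').b

theorem univ_comm : hD.univTop hd hi r w hd' ≫ d' =
    TypeIn.total hd hi r w (hD.liftProj hd hi r w hd') ≫ hD.univBot hd hi r w hd' := by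
  have h := (hD.liftFam hd hi r w hd').w
  rw [univTop, Category.assoc]
  refine (congrArg (_ ≫ ·) h).trans ?_
  rw [← Category.assoc, Pushforward.ev_comp, univBot, ← Category.assoc, ← Category.assoc]
  exact congrArg (· ≫ _) (TypeIn.total_extOver hd hi r w _ _ rfl).symm

/-- The map `var` into `I` is a pullback of `liftProj`, hence in `D`; by Frobenius the base change
`total` of `r` along it is anodyne. -/
theorem exists_univ_lift (hr : D.llp r) :
    ∃ l : (⟨i, hi, hD.liftProj hd hi r w hd'⟩ : TypeIn D _).ext ⟶ E',
      TypeIn.total hd hi r w _ ≫ l = hD.univTop hd hi r w hd' ∧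
        l ≫ d' = hD.univBot hd hi r w hd' := by
  have hw : D (⟨i, hi, hD.liftProj hd hi r w hd'⟩ : TypeIn D _).var :=
    D.of_isPullback (TypeIn.isPullback _).flip (hD.liftProj_mem hd hi r w hd')
  have := hD.llp_of_isPullback hr hw (TypeIn.isPullback_total hd hi r w _) d' hd'
  have sq : CommSq (hD.univTop hd hi r w hd') (TypeIn.total hd hi r w _) d'
    (hD.univBot hd hi r w hd') := ⟨hD.univ_comm hd hi r w hd'⟩
  exact ⟨sq.lift, sq.fac_left, sq.fac_right⟩

/-- A diagonal filler of the universal lifting problem. -/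
noncomputable def univLift (hr : D.llp r) :
    (⟨i, hi, hD.liftProj hd hi r w hd'⟩ : TypeIn D _).ext ⟶ E' :=
  (hD.exists_univ_lift hd hi r w hd' hr).choose

variable {Γ Δ : C} (b : Γ ⟶ U) (y : (⟨i, hi, b⟩ : TypeIn D Γ).ext ⟶ V)
  (x : (⟨d, hd, b⟩ : TypeIn D Γ).ext ⟶ E') (hxy : x ≫ d' = TypeIn.total hd hi r w b ≫ y)

/-- The map classifying the bottom of a lifting problem. -/
noncomputable abbrev botHom : Γ ⟶ (hD.fibreExp hi V).obj :=
  hD.classify ⟨i, hi, b⟩ ⟨d', hd', y⟩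

theorem botHom_proj : hD.botHom hi hd' b y ≫ (hD.fibreExp hi V).proj = b :=
  hD.classify_proj ⟨i, hi, b⟩ ⟨d', hd', y⟩

theorem extOver_botHom : (⟨i, hi, b⟩ : TypeIn D Γ).extOver (hD.botHom hi hd' b y)
    (hD.botHom_proj hi hd' b y) ≫ (hD.genericFam hi hd').b = y :=
  hD.classifyExt_fam ⟨i, hi, b⟩ ⟨d', hd', y⟩

/-- The top of a lifting problem as a map to the restricted universal family. -/
noncomputable def topHom :
    (⟨d, hd, b⟩ : TypeIn D Γ).ext ⟶ (hD.liftFam hd hi r w hd').ext :=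
  (hD.liftFam hd hi r w hd').isPullback.lift x
    ((⟨d, hd, b⟩ : TypeIn D Γ).extOver (hD.botHom hi hd' b y) (hD.botHom_proj hi hd' b y)) (by
      rw [hxy, ← Category.assoc, ← TypeIn.total_extOver, Category.assoc, extOver_botHom])

theorem topHom_var :
    hD.topHom hd hi r w hd' b y x hxy ≫ (hD.liftFam hd hi r w hd').var = x :=
  IsPullback.lift_fst _ _ _ _

theorem topHom_wk : hD.topHom hd hi r w hd' b y x hxy ≫ (hD.liftFam hd hi r w hd').wk =
    (⟨d, hd, b⟩ : TypeIn D Γ).extOver (hD.botHom hi hd' b y) (hD.botHom_proj hi hd' b y) :=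
  IsPullback.lift_snd _ _ _ _

/-- The map classifying a lifting problem. -/
noncomputable def problemHom : Γ ⟶ (hD.liftProblems hd hi r w hd').obj :=
  (hD.liftProblems hd hi r w hd').curry
    ((⟨d, hd, b⟩ : TypeIn D Γ).isPullback_extOver _ (hD.botHom_proj hi hd' b y))
    (hD.topHom hd hi r w hd' b y x hxy) (hD.topHom_wk hd hi r w hd' b y x hxy)

theorem problemHom_proj : hD.problemHom hd hi r w hd' b y x hxy ≫
    (hD.liftProblems hd hi r w hd').proj = hD.botHom hi hd' b y :=
  Pushforward.curry_proj _ _ _ _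

theorem problemHom_liftProj : hD.problemHom hd hi r w hd' b y x hxy ≫
    hD.liftProj hd hi r w hd' = b := by
  rw [liftProj, ← Category.assoc, problemHom_proj, botHom_proj]

/-- The diagonal filler of a lifting problem obtained from the universal one. -/
noncomputable def diagonal (hr : D.llp r) : (⟨i, hi, b⟩ : TypeIn D Γ).ext ⟶ E' :=
  (⟨i, hi, b⟩ : TypeIn D Γ).extOver (hD.problemHom hd hi r w hd' b y x hxy)
    (hD.problemHom_liftProj hd hi r w hd' b y x hxy) ≫ hD.univLift hd hi r w hd' hr

theorem diagonal_bot (hr : D.llp r) : hD.diagonal hd hi r w hd' b y x hxy hr ≫ d' = y := by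
  rw [diagonal, Category.assoc, univLift,
    (hD.exists_univ_lift hd hi r w hd' hr).choose_spec.2, univBot, ← Category.assoc]
  refine (congrArg (· ≫ _) (TypeIn.extOver_extOver _ _ _ _ rfl _
    (hD.problemHom_proj hd hi r w hd' b y x hxy))).trans ?_
  exact hD.extOver_botHom hi hd' b y

/-- Restricting the universal top map along the classifying map of the problem evaluates its
transpose, which gives back `x`. -/
theorem total_diagonal (hr : D.llp r) :
    TypeIn.total hd hi r w b ≫ hD.diagonal hd hi r w hd' b y x hxy hr = x := by
  rw [diagonal, ← Category.assoc, TypeIn.total_extOver, Category.assoc, univLift,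
    (hD.exists_univ_lift hd hi r w hd' hr).choose_spec.1, univTop, ← Category.assoc,
    Pushforward.comp_ev]
  refine Eq.trans ?_ (hD.topHom_var hd hi r w hd' b y x hxy)
  congr 1
  refine Eq.trans ?_ ((hD.liftProblems hd hi r w hd').ev_curry
    ((⟨d, hd, b⟩ : TypeIn D Γ).isPullback_extOver _ (hD.botHom_proj hi hd' b y))
    (hD.topHom hd hi r w hd' b y x hxy) (hD.topHom_wk hd hi r w hd' b y x hxy) (by
      rw [Category.assoc, Pushforward.curry_proj]
      exact TypeIn.extOver_wk _ _ _))
  congr 1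
  · exact TypeIn.extOver_extOver _ _ _ _ rfl _ (hD.problemHom_proj hd hi r w hd' b y x hxy)
  · exact TypeIn.extOver_wk _ _ _

theorem problemHom_subst (s : Δ ⟶ Γ)
    (h : ((⟨d, hd, b⟩ : TypeIn D Γ).extMap s ≫ x) ≫ d' =
      TypeIn.total hd hi r w (s ≫ b) ≫ (⟨i, hi, b⟩ : TypeIn D Γ).extMap s ≫ y) :
    hD.problemHom hd hi r w hd' (s ≫ b) ((⟨i, hi, b⟩ : TypeIn D Γ).extMap s ≫ y)
      ((⟨d, hd, b⟩ : TypeIn D Γ).extMap s ≫ x) h =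
      s ≫ hD.problemHom hd hi r w hd' b y x hxy := by
  have e : s ≫ hD.botHom hi hd' b y =
      hD.botHom hi hd' (s ≫ b) ((⟨i, hi, b⟩ : TypeIn D Γ).extMap s ≫ y) :=
    (hD.classify_subst ⟨i, hi, b⟩ ⟨d', hd', y⟩ s).symm
  have e₁ : (⟨d, hd, b⟩ : TypeIn D Γ).extMap s ≫ (⟨d, hd, b⟩ : TypeIn D Γ).extOver
      (hD.botHom hi hd' b y) (hD.botHom_proj hi hd' b y) =
      (⟨d, hd, s ≫ b⟩ : TypeIn D Δ).extOver
        (hD.botHom hi hd' (s ≫ b) ((⟨i, hi, b⟩ : TypeIn D Γ).extMap s ≫ y))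
        (hD.botHom_proj hi hd' (s ≫ b) _) := by
    rw [TypeIn.extMap_extOver]
    congr 1
  refine (Pushforward.comp_curry _ _ _ _ _ ((⟨d, hd, b⟩ : TypeIn D Γ).extMap s) _ _ e e₁
    (TypeIn.extMap_wk _ _) ?_).symm
  apply (hD.liftFam hd hi r w hd').isPullback.hom_ext
  · rw [Category.assoc, topHom_var, topHom_var]
  · rw [Category.assoc, topHom_wk, topHom_wk, e₁]

/-- Every filler is the one chosen map `univLift` restricted along a classifying map, so naturality
reduces to that of `problemHom`. -/
theorem diagonal_subst (hr : D.llp r) (s : Δ ⟶ Γ)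
    (h : ((⟨d, hd, b⟩ : TypeIn D Γ).extMap s ≫ x) ≫ d' =
      TypeIn.total hd hi r w (s ≫ b) ≫ (⟨i, hi, b⟩ : TypeIn D Γ).extMap s ≫ y) :
    hD.diagonal hd hi r w hd' (s ≫ b) ((⟨i, hi, b⟩ : TypeIn D Γ).extMap s ≫ y)
      ((⟨d, hd, b⟩ : TypeIn D Γ).extMap s ≫ x) h hr =
      (⟨i, hi, b⟩ : TypeIn D Γ).extMap s ≫ hD.diagonal hd hi r w hd' b y x hxy hr := by
  rw [diagonal, diagonal, ← Category.assoc, TypeIn.extMap_extOver]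
  congr 1
  congr 1
  exact hD.problemHom_subst hd hi r w hd' b y x hxy s h

end IsClosedClass

end UniversalLifting

/-! ### Path objects and identity types -/

section Identity

section

variable {C : Type u} [SmallCategory C] {D : MorphismProperty C}

theorem exists_parallel {Γ : Cᵒᵖ} (z : (pullback (typing D) (typing D)).obj Γ) {A : TypeIn D Γ.unop}
    (hA : (typing D).app Γ ((pullback.fst (typing D) (typing D)).app Γ z) = A) :
    ∃ a b : Γ.unop ⟶ A.tot, a ≫ A.d = A.b ∧ b ≫ A.d = A.b ∧
      (pullback.fst (typing D) (typing D)).app Γ z = A.term a ∧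
      (pullback.snd (typing D) (typing D)).app Γ z = A.term b := by
  obtain ⟨a, ha, ha'⟩ := TypeIn.exists_term hA
  obtain ⟨b, hb, hb'⟩ := TypeIn.exists_term ((pullback_condition_app z).symm.trans hA)
  exact ⟨a, b, ha, hb, ha'.symm, hb'.symm⟩

theorem diagonal_app_fst {Γ : Cᵒᵖ} (x : (termPsh D).obj Γ) :
    (pullback.fst (typing D) (typing D)).app Γ ((pullback.diagonal (typing D)).app Γ x) = x :=
  pullback_lift_app_fst _ _ _ x

theorem diagonal_app_snd {Γ : Cᵒᵖ} (x : (termPsh D).obj Γ) :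
    (pullback.snd (typing D) (typing D)).app Γ ((pullback.diagonal (typing D)).app Γ x) = x :=
  pullback_lift_app_snd _ _ _ x

end

variable {C : Type u} [SmallCategory C] {D : MorphismProperty C} [D.HasPullbacks]

/-- A path object of a map `d : E ⟶ U` in `D`: a factorization of its diagonal into an anodyne map
followed by a map in `D`. -/
structure PathObject {E U : C} {d : E ⟶ U} (hd : D d) where
  obj : C
  refl : E ⟶ obj
  ends : obj ⟶ (⟨d, hd, d⟩ : TypeIn D E).ext
  llp : D.llp refl
  mem : D ends
  refl_ends : refl ≫ ends = (⟨d, hd, d⟩ : TypeIn D E).isPullback.lift (𝟙 E) (𝟙 E) rfl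

namespace PathObject

variable {E U : C} {d : E ⟶ U} {hd : D d} (P : PathObject hd)

/-- The source of a path. -/
noncomputable abbrev src : P.obj ⟶ E := P.ends ≫ (⟨d, hd, d⟩ : TypeIn D E).var

/-- The target of a path. -/
noncomputable abbrev tgt : P.obj ⟶ E := P.ends ≫ (⟨d, hd, d⟩ : TypeIn D E).wk

/-- The projection of a path object to the base. -/
noncomputable abbrev base : P.obj ⟶ U := P.src ≫ d

theorem base_eq : P.base = P.tgt ≫ d := by
  rw [base, src, tgt, Category.assoc, Category.assoc]
  exact congrArg (P.ends ≫ ·) (⟨d, hd, d⟩ : TypeIn D E).w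

theorem refl_src : P.refl ≫ P.src = 𝟙 E := by
  rw [src, ← Category.assoc, P.refl_ends, IsPullback.lift_fst]

theorem refl_tgt : P.refl ≫ P.tgt = 𝟙 E := by
  rw [tgt, ← Category.assoc, P.refl_ends, IsPullback.lift_snd]

theorem refl_base : P.refl ≫ P.base = d := by
  rw [base, ← Category.assoc, refl_src, Category.id_comp]

/-- Going through the target, `base` is `ends`, then a pullback of `d`, then `d`: a composite of
`D`-maps. -/
theorem base_mem [D.IsStableUnderBaseChange] (hD : IsClosedClass D) : D P.base := by
  rw [base_eq]
  exact hD.comp_mem _ _ (hD.comp_mem _ _ P.mem (TypeIn.wk_mem _)) hd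

end PathObject

theorem IsFactorizing.nonempty_pathObject (hF : IsFactorizing D) {E U : C} {d : E ⟶ U} (hd : D d) :
    Nonempty (PathObject hd) := by
  obtain ⟨P, r, p, hr, hp, h⟩ := hF ((⟨d, hd, d⟩ : TypeIn D E).isPullback.lift (𝟙 E) (𝟙 E) rfl)
  exact ⟨⟨P, r, p, hr, hp, h⟩⟩

/-- A choice of path objects. -/
structure PathObjects (D : MorphismProperty C) [D.HasPullbacks] where
  pathObject : ∀ {E U : C} {d : E ⟶ U} (hd : D d), PathObject hd

variable (P : PathObjects D) {Γ Δ : C}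

/-- The pair of two parallel terms. -/
noncomputable def endpoints {E U : C} {d : E ⟶ U} (hd : D d) (a b : Γ ⟶ E) (h : a ≫ d = b ≫ d) :
    Γ ⟶ (⟨d, hd, d⟩ : TypeIn D E).ext :=
  (⟨d, hd, d⟩ : TypeIn D E).isPullback.lift a b h

theorem comp_endpoints {E U : C} {d : E ⟶ U} (hd : D d) (a b : Γ ⟶ E) (h : a ≫ d = b ≫ d)
    (s : Δ ⟶ Γ) (h' : (s ≫ a) ≫ d = (s ≫ b) ≫ d) :
    s ≫ endpoints hd a b h = endpoints hd (s ≫ a) (s ≫ b) h' := by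
  apply (⟨d, hd, d⟩ : TypeIn D E).isPullback.hom_ext
  · simp [endpoints]
  · simp [endpoints]

/-- The identity type of two parallel terms. -/
noncomputable abbrev idType {E U : C} {d : E ⟶ U} (hd : D d) (a b : Γ ⟶ E) (h : a ≫ d = b ≫ d) :
    TypeIn D Γ :=
  ⟨(P.pathObject hd).ends, (P.pathObject hd).mem, endpoints hd a b h⟩

/-- Terms of equal type share their `D`-map, so the path object of that map applies to both.
Quantifying over all presentations makes the chosen type computable from any of them. -/
theorem exists_idType {Γ : Cᵒᵖ} (z : (pullback (typing D) (typing D)).obj Γ) :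
    ∃ B : TypeIn D Γ.unop, ∀ {E U : C} {d : E ⟶ U} (hd : D d) (a b : Γ.unop ⟶ E)
      (h : a ≫ d = b ≫ d), (pullback.fst (typing D) (typing D)).app Γ z = (⟨d, hd, a⟩ : TermIn D _)
        →
      (pullback.snd (typing D) (typing D)).app Γ z = (⟨d, hd, b⟩ : TermIn D _) →
      B = idType P hd a b h := by
  obtain ⟨a, b, ha, hb, hz, hz'⟩ := exists_parallel z rfl
  refine ⟨idType P (TypeIn.mem _) a b (ha.trans hb.symm), fun hd a' b' h h₁ h₂ => ?_⟩
  rw [hz] at h₁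
  rw [hz'] at h₂
  -- With the common type a variable, `cases` can identify its `D`-map with the one presenting the
  -- two terms.
  generalize (typing D).app Γ ((pullback.fst (typing D) (typing D)).app Γ z) = A at *
  obtain ⟨d, hd', c⟩ := A
  cases h₁
  cases h₂
  rfl

/-- The map `Id`. -/
noncomputable def idMap : pullback (typing D) (typing D) ⟶ typePsh D where
  app Γ := ↾fun z => (exists_idType P z).choose
  naturality Γ Γ' s := by
    ext z
    obtain ⟨a, b, ha, hb, hz, hz'⟩ := exists_parallel z rfl
    have e := (exists_idType P z).choose_spec (TypeIn.mem _) a b (ha.trans hb.symm) hz hz'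
    have h' : (s.unop ≫ a) ≫ TypeIn.d _ = (s.unop ≫ b) ≫ TypeIn.d _ := by
      rw [Category.assoc, Category.assoc, ha, hb]
    have e' := (exists_idType P ((pullback (typing D) (typing D)).map s z)).choose_spec
      (TypeIn.mem _) (s.unop ≫ a) (s.unop ≫ b) h'
      ((NatTrans.naturality_apply _ _ _).trans (congrArg ((termPsh D).map s) hz))
      ((NatTrans.naturality_apply _ _ _).trans (congrArg ((termPsh D).map s) hz'))
    refine e'.trans (Eq.trans ?_ (congrArg (fun A : TypeIn D _ => A.subst s.unop) e).symm)
    exact congrArg (fun b => (⟨_, (P.pathObject _).mem, b⟩ : TypeIn D _))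
      (comp_endpoints _ a b (ha.trans hb.symm) _ h').symm

theorem idMap_app {Γ : Cᵒᵖ} (z : (pullback (typing D) (typing D)).obj Γ) {E U : C} {d : E ⟶ U}
    (hd : D d) (a b : Γ.unop ⟶ E) (h : a ≫ d = b ≫ d)
    (h₁ : (pullback.fst (typing D) (typing D)).app Γ z = (⟨d, hd, a⟩ : TermIn D _))
    (h₂ : (pullback.snd (typing D) (typing D)).app Γ z = (⟨d, hd, b⟩ : TermIn D _)) :
    (idMap P).app Γ z = idType P hd a b h :=
  (exists_idType P z).choose_spec hd a b h h₁ h₂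

/-- The map `i` of reflexivity terms. -/
noncomputable def reflMap : termPsh D ⟶ termPsh D where
  app _ := ↾fun x => ⟨(P.pathObject x.mem).ends, (P.pathObject x.mem).mem, x.a ≫
      (P.pathObject x.mem).refl⟩
  naturality _ _ s := by
    ext x
    exact congrArg (fun a => (⟨(P.pathObject x.mem).ends, (P.pathObject x.mem).mem, a⟩ : TermIn D
        _))
      (Category.assoc s.unop x.a _)

theorem diagonal_idMap : pullback.diagonal (typing D) ≫ idMap P = reflMap P ≫ typing D := by
  refine NatTrans.ext (funext fun Γ => ConcreteCategory.hom_ext _ _ fun x => ?_)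
  refine (idMap_app P ((pullback.diagonal (typing D)).app Γ x) x.mem x.a x.a rfl
    (diagonal_app_fst x) (diagonal_app_snd x)).trans ?_
  refine congrArg (fun b => (⟨(P.pathObject x.mem).ends, (P.pathObject x.mem).mem, b⟩ : TypeIn D
      _)) ?_
  refine Eq.trans ?_ (Category.assoc _ _ _).symm
  refine Eq.trans ?_ (congrArg (x.a ≫ ·) (P.pathObject x.mem).refl_ends).symm
  refine Eq.trans ?_ (comp_endpoints x.mem (𝟙 _) (𝟙 _) rfl x.a rfl).symm
  simp only [Category.comp_id]

section Paths

variable {E U : C} {d : E ⟶ U} (hd : D d)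

theorem exists_path (j : Γ ⟶ (P.pathObject hd).obj) :
    ∃ e : (pullback (idMap P) (typing D)).obj (op Γ),
      (pullback.fst (typing D) (typing D)).app _
        ((pullback.fst (idMap P) (typing D)).app _ e) =
          (⟨d, hd, j ≫ (P.pathObject hd).src⟩ : TermIn D Γ) ∧
      (pullback.snd (typing D) (typing D)).app _
        ((pullback.fst (idMap P) (typing D)).app _ e) =
          (⟨d, hd, j ≫ (P.pathObject hd).tgt⟩ : TermIn D Γ) ∧
      (pullback.snd (idMap P) (typing D)).app _ e =
        (⟨(P.pathObject hd).ends, (P.pathObject hd).mem, j⟩ : TermIn D Γ) := by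
  have h : (j ≫ (P.pathObject hd).src) ≫ d = (j ≫ (P.pathObject hd).tgt) ≫ d := by
    have := congrArg (j ≫ ·) (P.pathObject hd).base_eq
    simpa using this
  obtain ⟨z, hz, hz'⟩ := exists_pullback_elt (f := typing D) (g := typing D) (Γ := op Γ)
    (⟨d, hd, j ≫ (P.pathObject hd).src⟩ : TermIn D Γ)
        (⟨d, hd, j ≫ (P.pathObject hd).tgt⟩ : TermIn D Γ)
    (congrArg (fun b => (⟨d, hd, b⟩ : TypeIn D Γ)) h)
  obtain ⟨e, he, he'⟩ := exists_pullback_elt (f := idMap P) (g := typing D) (Γ := op Γ) z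
    (⟨(P.pathObject hd).ends, (P.pathObject hd).mem, j⟩ : TermIn D Γ) (by
      rw [idMap_app P z hd _ _ h hz hz']
      refine congrArg (fun b => (⟨(P.pathObject hd).ends, (P.pathObject hd).mem, b⟩ : TypeIn D _))
        ?_
      apply (⟨d, hd, d⟩ : TypeIn D E).isPullback.hom_ext
      · rw [endpoints, IsPullback.lift_fst, Category.assoc]
      · rw [endpoints, IsPullback.lift_snd, Category.assoc])
  exact ⟨e, by rw [he, hz], by rw [he, hz'], he'⟩

/-- The element of `I` given by a map to a path object. -/
noncomputable def path (j : Γ ⟶ (P.pathObject hd).obj) : (pullback (idMap P) (typing D)).obj (op Γ)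
    :=
  (exists_path P hd j).choose

theorem path_src (j : Γ ⟶ (P.pathObject hd).obj) :
    (pullback.fst (typing D) (typing D)).app _
      ((pullback.fst (idMap P) (typing D)).app _ (path P hd j)) =
        (⟨d, hd, j ≫ (P.pathObject hd).src⟩ : TermIn D Γ) :=
  (exists_path P hd j).choose_spec.1

theorem path_tgt (j : Γ ⟶ (P.pathObject hd).obj) :
    (pullback.snd (typing D) (typing D)).app _
      ((pullback.fst (idMap P) (typing D)).app _ (path P hd j)) =
        (⟨d, hd, j ≫ (P.pathObject hd).tgt⟩ : TermIn D Γ) :=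
  (exists_path P hd j).choose_spec.2.1

theorem path_term (j : Γ ⟶ (P.pathObject hd).obj) :
    (pullback.snd (idMap P) (typing D)).app _ (path P hd j) =
      (⟨(P.pathObject hd).ends, (P.pathObject hd).mem, j⟩ : TermIn D Γ) :=
  (exists_path P hd j).choose_spec.2.2

theorem eq_path (j : Γ ⟶ (P.pathObject hd).obj) (e : (pullback (idMap P) (typing D)).obj (op Γ))
    (h₁ : (pullback.fst (typing D) (typing D)).app _
      ((pullback.fst (idMap P) (typing D)).app _ e) =
        (⟨d, hd, j ≫ (P.pathObject hd).src⟩ : TermIn D Γ))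
    (h₂ : (pullback.snd (typing D) (typing D)).app _
      ((pullback.fst (idMap P) (typing D)).app _ e) =
        (⟨d, hd, j ≫ (P.pathObject hd).tgt⟩ : TermIn D Γ))
    (h₃ : (pullback.snd (idMap P) (typing D)).app _ e =
      (⟨(P.pathObject hd).ends, (P.pathObject hd).mem, j⟩ : TermIn D Γ)) : e = path P hd j := by
  refine pullback_elt_ext (pullback_elt_ext ?_ ?_) ?_
  · exact h₁.trans (path_src P hd j).symm
  · exact h₂.trans (path_tgt P hd j).symm
  · exact h₃.trans (path_term P hd j).symm

theorem map_path (j : Γ ⟶ (P.pathObject hd).obj) (s : Δ ⟶ Γ) :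
    (pullback (idMap P) (typing D)).map s.op (path P hd j) = path P hd (s ≫ j) := by
  apply eq_path
  · refine (congrArg _ (NatTrans.naturality_apply _ s.op _)).trans
      ((NatTrans.naturality_apply _ s.op _).trans
        ((congrArg ((termPsh D).map s.op) (path_src P hd j)).trans ?_))
    exact congrArg (fun a => (⟨d, hd, a⟩ : TermIn D Δ)) (Category.assoc _ _ _).symm
  · refine (congrArg _ (NatTrans.naturality_apply _ s.op _)).trans
      ((NatTrans.naturality_apply _ s.op _).trans
        ((congrArg ((termPsh D).map s.op) (path_tgt P hd j)).trans ?_))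
    exact congrArg (fun a => (⟨d, hd, a⟩ : TermIn D Δ)) (Category.assoc _ _ _).symm
  · exact (NatTrans.naturality_apply _ s.op _).trans
      (congrArg ((termPsh D).map s.op) (path_term P hd j))

theorem path_injective {j j' : Γ ⟶ (P.pathObject hd).obj} (h : path P hd j = path P hd j') :
    j = j' := by
  have h₁ := path_term P hd j
  rw [h] at h₁
  exact TypeIn.term_injective (h₁.symm.trans (path_term P hd j'))

theorem idProj_path (j : Γ ⟶ (P.pathObject hd).obj) :
    (idProj (typing D) (idMap P)).app _ (path P hd j) =
      (⟨d, hd, j ≫ (P.pathObject hd).base⟩ : TypeIn D Γ) := by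
  refine (congrArg ((typing D).app _) (path_src P hd j)).trans ?_
  exact congrArg (fun b => (⟨d, hd, b⟩ : TypeIn D Γ)) (Category.assoc _ _ _)

/-- The term component is a map into the path object over the pair of endpoints, so it already
determines both endpoints. With `path_injective`, elements of `I` over `A` are maps to the path
object over `A.b`. -/
theorem exists_eq_path (e : (pullback (idMap P) (typing D)).obj (op Γ)) (A : TypeIn D Γ)
    (h : (idProj (typing D) (idMap P)).app _ e = A) :
    ∃ j : Γ ⟶ (P.pathObject A.mem).obj, j ≫ (P.pathObject A.mem).base = A.b ∧ path P A.mem j = e :=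
        by
  obtain ⟨a, b, ha, hb, hz, hz'⟩ := exists_parallel ((pullback.fst (idMap P) (typing D)).app _ e) h
  have hI := idMap_app P _ A.mem a b (ha.trans hb.symm) hz hz'
  obtain ⟨j, hj, hj'⟩ := TypeIn.exists_term ((pullback_condition_app e).symm.trans hI)
  have hs : j ≫ (P.pathObject A.mem).src = a := by
    refine (Category.assoc _ _ _).symm.trans ((congrArg (· ≫ _) hj).trans ?_)
    exact IsPullback.lift_fst _ _ _ _
  have ht : j ≫ (P.pathObject A.mem).tgt = b := by
    refine (Category.assoc _ _ _).symm.trans ((congrArg (· ≫ _) hj).trans ?_)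
    exact IsPullback.lift_snd _ _ _ _
  refine ⟨j, ?_, (eq_path P A.mem j e ?_ ?_ ?_).symm⟩
  · rw [PathObject.base, ← Category.assoc, hs, ha]
  · rw [hs]
    exact hz
  · rw [ht]
    exact hz'
  · exact hj'.symm

theorem idRefl_app (x : TermIn D Γ) :
    (idRefl (typing D) (reflMap P) (idMap P) (diagonal_idMap P)).app (op Γ) x =
      path P x.mem (x.a ≫ (P.pathObject x.mem).refl) := by
  have h : (pullback.fst (idMap P) (typing D)).app (op Γ)
      ((idRefl (typing D) (reflMap P) (idMap P) (diagonal_idMap P)).app (op Γ) x) =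
      (pullback.diagonal (typing D)).app (op Γ) x :=
    pullback_lift_app_fst (Γ := op Γ) (pullback.diagonal (typing D)) (reflMap P)
      (diagonal_idMap P) x
  apply eq_path
  · refine (congrArg ((pullback.fst (typing D) (typing D)).app (op Γ)) h).trans
      ((diagonal_app_fst (Γ := op Γ) x).trans ?_)
    rw [Category.assoc, PathObject.refl_src, Category.comp_id]
  · refine (congrArg ((pullback.snd (typing D) (typing D)).app (op Γ)) h).trans
      ((diagonal_app_snd (Γ := op Γ) x).trans ?_)
    rw [Category.assoc, PathObject.refl_tgt, Category.comp_id]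
  · exact pullback_lift_app_snd (Γ := op Γ) (pullback.diagonal (typing D)) (reflMap P)
      (diagonal_idMap P) x

end Paths

variable [D.IsStableUnderBaseChange] (hD : IsClosedClass D)

/-- The type of paths in a type with unspecified endpoints. -/
noncomputable abbrev pathType (A : TypeIn D Γ) : TypeIn D Γ :=
  ⟨(P.pathObject A.mem).base, (P.pathObject A.mem).base_mem hD, A.b⟩

/-- The comprehension structure on the projection of `I` to `D₀`. -/
noncomputable abbrev idComprehension : Comprehension (idProj (typing D) (idMap P)) where
  ext a := op (pathType P hD a).ext
  wk a := (pathType P hD a).wk.op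
  var a := path P (TypeIn.mem a) (pathType P hD a).var
  app_var a := (idProj_path P (TypeIn.mem a) _).trans
    (congrArg (fun b => (⟨TypeIn.d a, TypeIn.mem a, b⟩ : TypeIn D _)) (pathType P hD a).w)
  lift a σ b h := ((pathType P hD a).isPullback.lift
    (exists_eq_path P b (TypeIn.subst a σ.unop) h).choose σ.unop
    (exists_eq_path P b (TypeIn.subst a σ.unop) h).choose_spec.1).op
  wk_lift a σ b h := Quiver.Hom.unop_inj ((pathType P hD a).isPullback.lift_snd _ _ _)
  map_lift a σ b h := by
    refine (map_path P _ _ _).trans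
      (Eq.trans ?_ (exists_eq_path P b (TypeIn.subst a σ.unop) h).choose_spec.2)
    rw [IsPullback.lift_fst]
  hom_ext {_ _ a t t'} h₁ h₂ := Quiver.Hom.unop_inj
    ((pathType P hD a).isPullback.hom_ext
      (path_injective P _ ((map_path P _ _ t.unop).symm.trans (h₂.trans (map_path P _ _ t'.unop))))
      (congrArg Quiver.Hom.unop h₁))

theorem idComprehension_extMap (A : TypeIn D Γ) (s : Δ ⟶ Γ) :
    (idComprehension P hD).extMap (Γ := op Γ) s.op A = ((pathType P hD A).extMap s).op := by
  apply (idComprehension P hD).hom_ext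
  · refine ((idComprehension P hD).wk_extMap (Γ := op Γ) s.op A).trans ?_
    exact congrArg Quiver.Hom.op ((pathType P hD A).extMap_wk s).symm
  · refine ((idComprehension P hD).map_extMap_var (Γ := op Γ) s.op A).trans ?_
    refine Eq.trans ?_ (map_path P _ _ _).symm
    exact congrArg (path P A.mem) ((pathType P hD A).extMap_var s).symm

/-- The reflexivity map over the extensions of a context. -/
noncomputable abbrev reflExt (A : TypeIn D Γ) : A.ext ⟶ (pathType P hD A).ext :=
  TypeIn.total A.mem ((P.pathObject A.mem).base_mem hD) (P.pathObject A.mem).refl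
      (P.pathObject A.mem).refl_base A.b

/-- Identifies the map of extensions represented by `ρ` with the base change of `refl`, so that
generic lifting problems of `ρ` against `typing D` are lifting problems in `C`. -/
theorem compare_idRefl (A : TypeIn D Γ) :
    Comprehension.compare (TypeIn.comprehension D) (idComprehension P hD)
      (idRefl (typing D) (reflMap P) (idMap P) (diagonal_idMap P))
      (idRefl_idProj (typing D) (reflMap P) (idMap P) (diagonal_idMap P)) (Γ := op Γ) A =
      (reflExt P hD A).op := by
  apply (idComprehension P hD).hom_ext
  · refine ((idComprehension P hD).wk_lift _ _ _ _).trans ?_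
    exact congrArg Quiver.Hom.op (TypeIn.total_wk A.mem ((P.pathObject A.mem).base_mem hD)
      (P.pathObject A.mem).refl (P.pathObject A.mem).refl_base A.b).symm
  · refine ((idComprehension P hD).map_lift _ _ _ _).trans ?_
    refine Eq.trans ?_ (map_path P _ _ _).symm
    refine (idRefl_app P _).trans ?_
    exact congrArg (path P A.mem) (TypeIn.total_var A.mem ((P.pathObject A.mem).base_mem hD)
      (P.pathObject A.mem).refl (P.pathObject A.mem).refl_base A.b).symm

/-- The eliminator: the filler of a generic lifting problem. -/
noncomputable def elim (A : TypeIn D Γ) (x : TypeIn D (pathType P hD A).ext) (y : TermIn D A.ext)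
    (e : x.subst (reflExt P hD A) = y.type) : TermIn D (pathType P hD A).ext :=
  x.term (hD.diagonal A.mem ((P.pathObject A.mem).base_mem hD) (P.pathObject A.mem).refl
      (P.pathObject A.mem).refl_base x.mem A.b
    x.b ((x.subst (reflExt P hD A)).sect y e.symm) ((x.subst (reflExt P hD A)).sect_d y e.symm)
    (P.pathObject A.mem).llp)

theorem elim_type (A : TypeIn D Γ) (x : TypeIn D (pathType P hD A).ext) (y : TermIn D A.ext)
    (e : x.subst (reflExt P hD A) = y.type) : (elim P hD A x y e).type = x :=
  TypeIn.term_type (hD.diagonal_bot _ _ _ _ _ _ _ _ _ _)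

theorem elim_subst_refl (A : TypeIn D Γ) (x : TypeIn D (pathType P hD A).ext) (y : TermIn D A.ext)
    (e : x.subst (reflExt P hD A) = y.type) : (elim P hD A x y e).subst (reflExt P hD A) = y := by
  refine Eq.trans ?_ ((x.subst (reflExt P hD A)).term_sect y e.symm)
  exact congrArg (fun a => (⟨x.d, x.mem, a⟩ : TermIn D _))
    (hD.total_diagonal _ _ _ _ _ _ _ _ _ _)

theorem elim_subst (A : TypeIn D Γ) (x : TypeIn D (pathType P hD A).ext) (y : TermIn D A.ext)
    (e : x.subst (reflExt P hD A) = y.type) (s : Δ ⟶ Γ)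
    (e' : (x.subst ((pathType P hD A).extMap s)).subst (reflExt P hD (A.subst s)) =
      (y.subst (A.extMap s)).type) :
    elim P hD (A.subst s) (x.subst ((pathType P hD A).extMap s)) (y.subst (A.extMap s)) e' =
      (elim P hD A x y e).subst ((pathType P hD A).extMap s) := by
  refine congrArg (fun a => (⟨x.d, x.mem, a⟩ : TermIn D _)) ?_
  have h : ((x.subst ((pathType P hD A).extMap s)).subst (reflExt P hD (A.subst s))).sect
      (y.subst (A.extMap s)) e'.symm =
      A.extMap s ≫ (x.subst (reflExt P hD A)).sect y e.symm := by
    have h₁ := (x.subst (reflExt P hD A)).term_sect y e.symm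
    refine TypeIn.term_injective ((TypeIn.term_sect _ _ e'.symm).trans ?_)
    exact congrArg (fun t : TermIn D _ => t.subst (A.extMap s)) h₁.symm
  have h₂ := TypeIn.sect_d _ _ e'.symm
  rw [h] at h₂
  refine Eq.trans ?_ (hD.diagonal_subst A.mem ((P.pathObject A.mem).base_mem hD)
      (P.pathObject A.mem).refl
    (P.pathObject A.mem).refl_base x.mem A.b x.b _ (TypeIn.sect_d _ _ e.symm)
        (P.pathObject A.mem).llp s h₂)
  congr 1

/-- The substitution map of `idComprehension` is built from chosen paths and agrees with that of
`pathType` only propositionally, so `m` is left variable. -/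
theorem elim_subst_of_eq (A : TypeIn D Γ) (x : TypeIn D (pathType P hD A).ext) (y : TermIn D A.ext)
    (e : x.subst (reflExt P hD A) = y.type) (s : Δ ⟶ Γ)
    {m : (pathType P hD (A.subst s)).ext ⟶ (pathType P hD A).ext}
    (hm : m = (pathType P hD A).extMap s)
    (e' : (x.subst m).subst (reflExt P hD (A.subst s)) = (y.subst (A.extMap s)).type) :
    elim P hD (A.subst s) (x.subst m) (y.subst (A.extMap s)) e' = (elim P hD A x y e).subst m := by
  subst hm
  exact elim_subst P hD A x y e s e'

theorem map_compare_idRefl {Γ : Cᵒᵖ} (F : Cᵒᵖ ⥤ Type u) (A : TypeIn D Γ.unop)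
    (x : F.obj (op (pathType P hD A).ext)) :
    F.map (Comprehension.compare (TypeIn.comprehension D) (idComprehension P hD)
      (idRefl (typing D) (reflMap P) (idMap P) (diagonal_idMap P))
      (idRefl_idProj (typing D) (reflMap P) (idMap P) (diagonal_idMap P)) (Γ := Γ) A) x =
      F.map (reflExt P hD A).op x :=
  congrArg (fun m : op (pathType P hD A).ext ⟶ op A.ext => F.map m x) (compare_idRefl P hD A)

/-- The fillers of the generic lifting problems of `ρ` against `π`. -/
noncomputable def idFillers : GenericFillers (TypeIn.comprehension D) (idComprehension P hD)
    (idRefl (typing D) (reflMap P) (idMap P) (diagonal_idMap P)) (typing D)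
    (idRefl_idProj (typing D) (reflMap P) (idMap P) (diagonal_idMap P)) where
  fill a x y e := elim P hD a x y ((map_compare_idRefl P hD (typePsh D) a x).symm.trans e)
  app_fill a x y _ := elim_type P hD a x y _
  map_fill a x y _ := (map_compare_idRefl P hD (termPsh D) a _).trans (elim_subst_refl P hD a x y _)
  fill_map s a x y _ _ := elim_subst_of_eq P hD a x y _ s.unop
    (congrArg Quiver.Hom.unop (idComprehension_extMap P hD a s.unop)) _

theorem IsClosedClass.modelsId (hD : IsClosedClass D) (hF : IsFactorizing D) :
    ModelsId (typing D) :=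
  let P : PathObjects D := ⟨fun hd => (hF.nonempty_pathObject hd).some⟩
  ⟨reflMap P, idMap P, diagonal_idMap P, ⟨(idFillers P hD).leftLiftingStructure⟩⟩

end Identity

end NaturalModel

theorem mainTheorem1 {C : Type u} [SmallCategory C] (D : MorphismProperty C)
    [D.HasPullbacks] [D.IsStableUnderBaseChange]
    (hclosed : NaturalModel.IsClosedClass D) (hfact : NaturalModel.IsFactorizing D) :
    yoneda.relativelyRepresentable (NaturalModel.typing D) ∧
      NaturalModel.ModelsSigma (NaturalModel.typing D) ∧
      NaturalModel.ModelsPi (NaturalModel.typing D) ∧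
      NaturalModel.ModelsId (NaturalModel.typing D) :=
  ⟨(NaturalModel.TypeIn.comprehension D).relativelyRepresentable, hclosed.modelsSigma,
    hclosed.modelsPi, hclosed.modelsId hfact⟩
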